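/- Let $m\ge 0$ and $p\ge 0$ be integers. All systems are $m\times m$ proper real-rational transfer matrices; poles are counted with McMillan multiplicity. A transfer matrix is called stable if it has no pole in the closed right half-plane, and $p$-dominant if it has no pole on the imaginary axis and exactly $p$ poles in the open right half-plane. The positive feedback system $P\#C$ is called $p$-dominant if $I-P(\infty)C(\infty)$ is invertible and the closed-loop transfer matrix $\begin{pmatrix} I & -C\\ -P & I\end{pmatrix}^{-1}$ is proper and $p$-dominant. For $x,y\in\mathbb C^m\setminus\{0\}$ put $\gamma(x,y)=\|y\|_2/\|x\|_2$ and $\theta(x,y)=\arccos\frac{\mathrm{Re}(x^*y)}{\|x\|_2\|y\|_2}$, and for $A\in\mathbb C^{m\times m}$ let $$\mathrm{SG}(A)=\{\gamma(x,Ax)e^{\pm j\theta(x,Ax)} : x\neq 0,\ Ax\neq 0\},\qquad \mathrm{SG}^\dagger(A)=\{\gamma(Ax,x)e^{\pm j\theta(Ax,x)} : x\neq 0,\ Ax\neq 0\}.$$ Let $P$ and $C$ be proper real-rational $m\times m$ transfer matrices such that $I-CP$ is invertible as a rational matrix, and suppose that the loop formed by $P$ and $C$ has no unstable pole-zero cancellation: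 the number of poles in the closed right half-plane of $PC$, and likewise that of $CP$, equals the sum of those of $P$ and of $C$. Suppose that $G=(I-CP)^{-1}C$ is $p$-dominant. For each $\omega\in[-\infty,\infty]$ let $\rho(\omega)\subset\mathbb C$ be a closed simply connected set symmetric with respect to the real axis, and suppose that $$\inf_{z\in \mathrm{SG}^\dagger(G(j\omega))}\mathrm{dist}(z,\tau\rho(\omega))>0\qquad\text{for all }\omega\in[-\infty,\infty]\text{ and all }\tau\in[0,1]$$ (where $G(\pm j\infty)=G(\infty)$ and an infimum over the empty set is $+\infty$). Then for every proper stable real-rational $\Delta$ with $\mathrm{SG}(\Delta(j\omega))\subset\rho(\omega)$ for all $\omega\in[-\infty,\infty]$, the uncertain feedback system $(P+\Delta)\#C$ is $p$-dominant. -/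

import Mathlib

open scoped Pointwise

noncomputable section

namespace SGDominance

/-! ### Real-rational transfer matrices, poles, dominance -/

/-- The `k × k` minors (`k ≤ card ι`) of a rational matrix, indexed by a row selection and a column
selection. Selections with repetitions give the minor `0`, and reordering a selection only changes
the sign. -/
def minor {ι : Type*} [Fintype ι] (G : Matrix ι ι (RatFunc ℝ))
    (x : Σ k : Fin (Fintype.card ι + 1), (Fin k → ι) × (Fin k → ι)) : RatFunc ℝ :=
  (G.submatrix x.2.1 x.2.2).det

open Classical in
/-- The (finite) poles of a rational matrix with their McMillan multiplicities: the complex roots,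
with multiplicity, of the pole polynomial, i.e. of the least common multiple of the denominators
(in lowest terms) of all minors. The supremum of multisets takes the maximal multiplicity of each
point, which is the multiset of roots of the least common multiple. -/
def poles {ι : Type*} [Fintype ι] (G : Matrix ι ι (RatFunc ℝ)) : Multiset ℂ :=
  Finset.univ.sup fun x => (minor G x).denom.aroots ℂ

/-- Entrywise proper real-rational matrices. -/
def IsProper {ι : Type*} (G : Matrix ι ι (RatFunc ℝ)) : Prop :=
  ∀ i j, (G i j).num.natDegree ≤ (G i j).denom.natDegree

/-- Proper, and no poles on the imaginary axis. -/
def IsRLinf {ι : Type*} [Fintype ι] (G : Matrix ι ι (RatFunc ℝ)) : Prop :=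
  IsProper G ∧ ∀ s ∈ poles G, s.re ≠ 0

/-- Stable: proper, and no poles in the closed right half-plane. -/
def IsRHinf {ι : Type*} [Fintype ι] (G : Matrix ι ι (RatFunc ℝ)) : Prop :=
  IsProper G ∧ ∀ s ∈ poles G, s.re < 0

open Classical in
/-- `p`-dominance of a system: no imaginary-axis poles, `p` poles in the open right half-plane. -/
def IsDominant {ι : Type*} [Fintype ι] (G : Matrix ι ι (RatFunc ℝ)) (p : ℕ) : Prop :=
  IsRLinf G ∧ (poles G).countP (fun s => 0 < s.re) = p

open Classical in
/-- The number of poles in the closed right half-plane. -/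
def numClosedRHPPoles {ι : Type*} [Fintype ι] (G : Matrix ι ι (RatFunc ℝ)) : ℕ :=
  (poles G).countP (fun s => 0 ≤ s.re)

/-- No unstable pole-zero cancellation in the product `P * C`. -/
def NoUnstableCancellation {m : ℕ} (P C : Matrix (Fin m) (Fin m) (RatFunc ℝ)) : Prop :=
  numClosedRHPPoles (P * C) = numClosedRHPPoles P + numClosedRHPPoles C

/-! ### Frequency response on the extended imaginary axis -/

/-- The value at infinity of a proper rational function. -/
def valueAtInfty (f : RatFunc ℝ) : ℝ :=
  f.num.coeff f.denom.natDegree / f.denom.leadingCoeff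

open Classical in
/-- The frequency response `G(jω)` for `ω ∈ [-∞, ∞]`, with `G(±j∞) = G(∞)`. -/
def freqResp {m : ℕ} (G : Matrix (Fin m) (Fin m) (RatFunc ℝ)) (ω : EReal) :
    Matrix (Fin m) (Fin m) ℂ :=
  if ω = ⊤ ∨ ω = ⊥ then G.map fun f => (valueAtInfty f : ℂ)
  else G.map fun f => f.eval (algebraMap ℝ ℂ) (Complex.I * (ω.toReal : ℂ))

/-! ### Positive feedback interconnections -/

/-- `I - P(∞) C(∞)` has full rank. -/
def WellPosed {m : ℕ} (P C : Matrix (Fin m) (Fin m) (RatFunc ℝ)) : Prop :=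
  IsUnit (1 - P.map valueAtInfty * C.map valueAtInfty)

/-- The closed-loop transfer matrix from the external inputs `(w₁, w₂)` to `(u₁, u₂)`. -/
def closedLoop {m : ℕ} (P C : Matrix (Fin m) (Fin m) (RatFunc ℝ)) :
    Matrix (Fin m ⊕ Fin m) (Fin m ⊕ Fin m) (RatFunc ℝ) :=
  (Matrix.fromBlocks 1 (-C) (-P) 1)⁻¹

/-- `p`-dominance of the feedback system `P # C`. -/
def IsFeedbackDominant {m : ℕ} (P C : Matrix (Fin m) (Fin m) (RatFunc ℝ)) (p : ℕ) : Prop :=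
  WellPosed P C ∧ IsDominant (closedLoop P C) p

/-! ### Scaled graphs of complex matrices -/

/-- The gain from `x` to `y`, used for `x ≠ 0` only. -/
def gain {m : ℕ} (x y : EuclideanSpace ℂ (Fin m)) : ℝ := ‖y‖ / ‖x‖

/-- The phase from `x` to `y`, used for `x, y ≠ 0` only. -/
def phase {m : ℕ} (x y : EuclideanSpace ℂ (Fin m)) : ℝ :=
  Real.arccos ((inner ℂ x y).re / (‖x‖ * ‖y‖))

/-- The two points `γ(x, y) e^{± j θ(x, y)}`. -/
def gainPhasePoints {m : ℕ} (x y : EuclideanSpace ℂ (Fin m)) : Set ℂ :=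
  {(gain x y : ℂ) * Complex.exp (Complex.I * (phase x y : ℂ)),
   (gain x y : ℂ) * Complex.exp (-(Complex.I * (phase x y : ℂ)))}

/-- The scaled graph of a matrix. -/
def SG {m : ℕ} (A : Matrix (Fin m) (Fin m) ℂ) : Set ℂ :=
  {z | ∃ x : EuclideanSpace ℂ (Fin m), x ≠ 0 ∧ A.toEuclideanLin x ≠ 0 ∧
    z ∈ gainPhasePoints x (A.toEuclideanLin x)}

/-- The inverse scaled graph of a matrix. -/
def invSG {m : ℕ} (A : Matrix (Fin m) (Fin m) ℂ) : Set ℂ :=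
  {z | ∃ x : EuclideanSpace ℂ (Fin m), x ≠ 0 ∧ A.toEuclideanLin x ≠ 0 ∧
    z ∈ gainPhasePoints (A.toEuclideanLin x) x}

/-! ### Uncertainty sets -/

/-- Closed simply connected sets in `ℂ` that are symmetric with respect to the real axis. -/
def IsUncertaintyRegion (S : Set ℂ) : Prop :=
  IsClosed S ∧ IsSimplyConnected S ∧ ∀ z ∈ S, (starRingEnd ℂ) z ∈ S

/-- The stable uncertainties whose scaled graph at frequency `ω` lies in `ρ ω`, for every
`ω ∈ [-∞, ∞]`. -/
def uncertaintySet (m : ℕ) (ρ : EReal → Set ℂ) : Set (Matrix (Fin m) (Fin m) (RatFunc ℝ)) :=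
  {Δ | IsRHinf Δ ∧ ∀ ω : EReal, SG (freqResp Δ ω) ⊆ ρ ω}

end SGDominance

end

/-!
Write `δ_s(A)` for the multiplicity of the complex number `s` as a pole of `A` (the largest pole
order at `s` of a minor) and `v_s` for the order of vanishing at `s`. The proof compares, at each
`s` in the closed right half-plane, the poles of the uncertain loop with those of
`G = (1 - C P)⁻¹ C`.

*Pole multiplicities.* Over the valuation ring at `s` every matrix has a right coprime fraction
`A = N D⁻¹`, and `δ_s(A) = v_s(det D)` for every such fraction (`exists_rightCoprime`,
`RightCoprime.det_mul_polarSize`). Existence is Cramer's rule: take `D⁻¹` to be the square submatrix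
of `[1; A]` whose determinant has the highest pole order. Computing with such fractions gives

* `δ_s(P # C) = δ_s(P) + δ_s(C) + v_s(det (1 - P C))` (`det_mul_polarSize_closedLoop`);
* the same value for `δ_s(G)`, if nothing cancels at `s` in `P C` and in `C P`
  (`det_mul_polarSize_of_no_cancellation`);
* `δ_s(P + Δ) = δ_s(P)`, if `Δ` has no pole at `s` (`polarSize_add_integral`).

As `1 - C (P + Δ) = (1 - C P) (1 - G Δ)`, this yields
`δ_s((P + Δ) # C) = δ_s(G) + v_s(det (1 - G Δ))` on the closed right half-plane. It remains to see
that `det (1 - G Δ)` has no zero on the imaginary axis and as many zeros as poles to its right.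

*Homotopy.* A null vector of `1 - τ G(jω) Δ(jω)` would produce a common point of the inverse scaled
graph of `G(jω)` and of `τ ρ(ω)` (`det_one_sub_smul_mul_ne_zero`). So `det (1 - τ G Δ)` does not
vanish on the extended imaginary axis for `0 ≤ τ ≤ 1`; after clearing denominators it becomes a
family of polynomials of constant degree, without imaginary roots and with coefficients continuous
in `τ`. In such a family the number of roots in the right half-plane is constant
(`countP_roots_re_pos_eq`), and at `τ = 0` the determinant is `1`.

*Infinity.* Properness and well-posedness are the same computations at the place at infinity:
`1 - C P` has the proper inverse `1 + G P`, so its determinant is a unit there, and so is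
`det (1 - G Δ)`.

Valuations are written multiplicatively, so `polarSize (valAt s) A` is the exponential of `δ_s(A)`.
-/

namespace SGDominance

/-! ### Pole multiplicities at a valuation -/

section Valuation

variable {K Γ₀ ι : Type*} [Field K] [LinearOrderedCommGroupWithZero Γ₀]

/-- A matrix whose entries lie in the valuation ring of `v`. -/
def IntegralAt {κ : Type*} (v : Valuation K Γ₀) (A : Matrix ι κ K) : Prop :=
  ∀ i j, v (A i j) ≤ 1

variable {v : Valuation K Γ₀}

namespace IntegralAt

theorem add {A B : Matrix ι ι K} (hA : IntegralAt v A) (hB : IntegralAt v B) :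
    IntegralAt v (A + B) := fun i j => v.map_add_le (hA i j) (hB i j)

theorem neg {A : Matrix ι ι K} (hA : IntegralAt v A) : IntegralAt v (-A) := fun i j => by
  simpa using hA i j

theorem sub {A B : Matrix ι ι K} (hA : IntegralAt v A) (hB : IntegralAt v B) :
    IntegralAt v (A - B) := by
  rw [sub_eq_add_neg]; exact hA.add hB.neg

theorem transpose {A : Matrix ι ι K} (hA : IntegralAt v A) : IntegralAt v A.transpose :=
  fun i j => hA j i

theorem mul [Fintype ι] {A B : Matrix ι ι K} (hA : IntegralAt v A) (hB : IntegralAt v B) :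
    IntegralAt v (A * B) := fun i j => by
  rw [Matrix.mul_apply]
  exact v.map_sum_le fun k _ => by rw [map_mul]; exact mul_le_one' (hA i k) (hB k j)

theorem zero : IntegralAt v (0 : Matrix ι ι K) := fun i j => by simp

theorem one [DecidableEq ι] : IntegralAt v (1 : Matrix ι ι K) := fun i j => by
  rw [Matrix.one_apply]; split_ifs <;> simp

theorem fromBlocks {A B C D : Matrix ι ι K} (hA : IntegralAt v A) (hB : IntegralAt v B)
    (hC : IntegralAt v C) (hD : IntegralAt v D) : IntegralAt v (Matrix.fromBlocks A B C D) := by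
  rintro (i | i) (j | j)
  exacts [hA i j, hB i j, hC i j, hD i j]

theorem det [Fintype ι] [DecidableEq ι] {A : Matrix ι ι K} (hA : IntegralAt v A) :
    v A.det ≤ 1 := by
  rw [Matrix.det_apply']
  refine v.map_sum_le fun σ _ => ?_
  rw [map_mul, map_prod]
  refine mul_le_one' ?_ (Finset.prod_le_one' fun i _ => hA _ _)
  rcases Int.units_eq_one_or (Equiv.Perm.sign σ) with h | h <;> simp [h]

theorem inv [Fintype ι] [DecidableEq ι] {A : Matrix ι ι K} (hA : IntegralAt v A)
    (hdet : v A.det = 1) : IntegralAt v A⁻¹ := fun i j => by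
  rw [Matrix.inv_def, Matrix.smul_apply, Matrix.adjugate_apply, smul_eq_mul, map_mul,
    Ring.inverse_eq_inv', map_inv₀, hdet, inv_one, one_mul]
  refine det fun a b => ?_
  rw [Matrix.updateRow_apply]
  split_ifs
  · rw [Pi.single_apply]; split_ifs <;> simp
  · exact hA a b

end IntegralAt

variable [Fintype ι]

/-- The largest value of `v` on the minors of `G`; the empty minor makes it at least `1`. For the
valuation at a point of the plane it is the exponential of the multiplicity of that point as a pole
of `G`. -/
def polarSize (v : Valuation K Γ₀) (G : Matrix ι ι K) : Γ₀ :=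
  (Finset.univ : Finset (Σ k : Fin (Fintype.card ι + 1), (Fin k → ι) × (Fin k → ι))).sup'
    ⟨⟨0, Fin.elim0, Fin.elim0⟩, Finset.mem_univ _⟩
    fun x => v (G.submatrix x.2.1 x.2.2).det

theorem minor_le_polarSize (G : Matrix ι ι K) {k : ℕ} (hk : k ≤ Fintype.card ι)
    (r c : Fin k → ι) : v (G.submatrix r c).det ≤ polarSize v G := by
  have h := Finset.le_sup' (fun x : Σ k : Fin (Fintype.card ι + 1), (Fin k → ι) × (Fin k → ι) =>
    v (G.submatrix x.2.1 x.2.2).det)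
    (Finset.mem_univ (⟨⟨k, Nat.lt_succ_of_le hk⟩, r, c⟩ :
      Σ k : Fin (Fintype.card ι + 1), (Fin k → ι) × (Fin k → ι)))
  unfold polarSize
  exact h

theorem exists_minor_eq_polarSize (v : Valuation K Γ₀) (G : Matrix ι ι K) :
    ∃ k : ℕ, k ≤ Fintype.card ι ∧ ∃ r c : Fin k → ι, v (G.submatrix r c).det = polarSize v G := by
  obtain ⟨x, -, hx⟩ := Finset.exists_mem_eq_sup' (s := Finset.univ)
    ⟨⟨0, Fin.elim0, Fin.elim0⟩, Finset.mem_univ _⟩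
    (fun x : Σ k : Fin (Fintype.card ι + 1), (Fin k → ι) × (Fin k → ι) =>
      v (G.submatrix x.2.1 x.2.2).det)
  exact ⟨x.1, Nat.le_of_lt_succ x.1.2, x.2.1, x.2.2, hx.symm⟩

theorem one_le_polarSize (G : Matrix ι ι K) : 1 ≤ polarSize v G := by
  have := minor_le_polarSize (v := v) G (Nat.zero_le _) Fin.elim0 Fin.elim0
  simpa using this

theorem polarSize_ne_zero (G : Matrix ι ι K) : polarSize v G ≠ 0 :=
  (lt_of_lt_of_le zero_lt_one (one_le_polarSize G)).ne'

theorem polarSize_transpose (G : Matrix ι ι K) : polarSize v G.transpose = polarSize v G := by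
  have key : ∀ H : Matrix ι ι K, polarSize v H.transpose ≤ polarSize v H := fun H => by
    obtain ⟨k, hk, r, c, h⟩ := exists_minor_eq_polarSize v H.transpose
    rw [← h, ← Matrix.det_transpose]
    exact minor_le_polarSize H hk c r
  exact le_antisymm (key G) (by simpa using key G.transpose)

/-- A determinant whose rows are standard basis rows (possibly truncated to `0`) or rows of `G`
expands along its basis rows to a minor of `G`, up to sign. -/
theorem val_det_le_polarSize_of_fin (G : Matrix ι ι K) :
    ∀ (n : ℕ), n ≤ Fintype.card ι → ∀ (c : Fin n → ι) (B : Matrix (Fin n) (Fin n) K),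
      (∀ i, (∃ j, B i = Pi.single j 1) ∨ B i = 0 ∨ ∃ r, B i = fun j => G r (c j)) →
      v B.det ≤ polarSize v G := by
  intro n
  induction n with
  | zero => intro _ c B _; simpa using one_le_polarSize G
  | succ n ih =>
    intro hn c B hB
    by_cases hall : ∀ i, ∃ r, B i = fun j => G r (c j)
    · choose r hr using hall
      have : B = G.submatrix r c := by ext i j; rw [hr]; rfl
      rw [this]
      exact minor_le_polarSize G hn r c
    · push Not at hall
      obtain ⟨i, hi⟩ := hall
      rcases hB i with ⟨j, hj⟩ | h0 | ⟨r, hr⟩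
      · rw [Matrix.det_succ_row B i, Finset.sum_eq_single j]
        · rw [map_mul, map_mul, hj, map_pow, Valuation.map_neg, map_one, one_pow, one_mul,
            Pi.single_eq_same, map_one, one_mul]
          refine ih (by omega) (c ∘ j.succAbove) _ fun i' => ?_
          rcases hB (i.succAbove i') with ⟨l, hl⟩ | h0 | ⟨r, hr⟩
          · by_cases hlj : l = j
            · right; left
              ext a
              rw [Matrix.submatrix_apply, hl, hlj, Pi.single_eq_of_ne (Fin.succAbove_ne j a)]
              rfl
            · left
              obtain ⟨l', rfl⟩ := Fin.exists_succAbove_eq hlj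
              refine ⟨l', ?_⟩
              ext a
              rw [Matrix.submatrix_apply, hl]
              simp [Pi.single_apply]
          · right; left
            ext a; rw [Matrix.submatrix_apply, h0]; rfl
          · right; right
            exact ⟨r, by ext a; rw [Matrix.submatrix_apply, hr]; rfl⟩
        · intro b _ hb
          rw [hj, Pi.single_eq_of_ne hb]; simp
        · simp
      · rw [Matrix.det_eq_zero_of_row_eq_zero i (fun j => by rw [h0]; rfl), map_zero]
        exact zero_le
      · exact absurd hr (hi r)

variable [DecidableEq ι]

/-- A square submatrix of `[1; G]` (in any order of the rows, with repetitions) has determinant at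
most `polarSize v G`. -/
theorem val_det_le_polarSize (G B : Matrix ι ι K)
    (hB : ∀ i, (∃ j, B i = Pi.single j 1) ∨ ∃ r, B i = G r) : v B.det ≤ polarSize v G := by
  let e := (Fintype.equivFin ι).symm
  rw [← Matrix.det_submatrix_equiv_self e B]
  refine val_det_le_polarSize_of_fin G _ le_rfl e _ fun i => ?_
  rcases hB (e i) with ⟨j, hj⟩ | ⟨r, hr⟩
  · refine .inl ⟨e.symm j, ?_⟩
    ext a
    simp [Matrix.submatrix_apply, hj, Pi.single_apply, Equiv.eq_symm_apply]
  · exact .inr (.inr ⟨r, by ext a; rw [Matrix.submatrix_apply, hr]⟩)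

/-- The bound is attained: replace in `1` the rows numbered by the columns of a largest minor of `G`
by the rows of that minor. -/
theorem exists_det_eq_polarSize (v : Valuation K Γ₀) (G : Matrix ι ι K) :
    ∃ B : Matrix ι ι K, (∀ i, (∃ j, B i = Pi.single j 1) ∨ ∃ r, B i = G r) ∧
      v B.det = polarSize v G := by
  obtain ⟨k, hk, r, c, h⟩ := exists_minor_eq_polarSize v G
  have hc : Function.Injective c := by
    intro a b hab
    by_contra hne
    apply polarSize_ne_zero (v := v) G
    rw [← h, Matrix.det_zero_of_column_eq hne (fun i => by simp [hab]), map_zero]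
  classical
  let B : Matrix ι ι K := fun i =>
    if hi : ∃ a, c a = i then G (r hi.choose) else Pi.single i 1
  have hBc : ∀ a, B (c a) = G (r a) := fun a => by
    have hi : ∃ a', c a' = c a := ⟨a, rfl⟩
    simp only [B, dif_pos hi]
    rw [hc hi.choose_spec]
  have hBn : ∀ i, (¬ ∃ a, c a = i) → B i = Pi.single i 1 := fun i hi => by
    simp only [B, dif_neg hi]
  refine ⟨B, fun i => ?_, ?_⟩
  · by_cases hi : ∃ a, c a = i
    · obtain ⟨a, rfl⟩ := hi
      exact .inr ⟨_, hBc a⟩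
    · exact .inl ⟨_, hBn i hi⟩
  · rw [← h, Matrix.twoBlockTriangular_det B (fun i => ∃ a, c a = i)]
    · have h2 : (B.toSquareBlockProp fun i => ¬ ∃ a, c a = i) = 1 := by
        ext i j
        rw [Matrix.toSquareBlockProp_def, Matrix.of_apply, hBn _ i.2, Matrix.one_apply,
          Pi.single_apply]
        simp only [Subtype.ext_iff, eq_comm]
      let e : Fin k ≃ {i // ∃ a, c a = i} := Equiv.ofInjective c hc
      rw [h2, Matrix.det_one, mul_one, ← Matrix.det_submatrix_equiv_self e]
      congr 2
      ext a b
      rw [Matrix.submatrix_apply, Matrix.toSquareBlockProp_def, Matrix.of_apply]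
      change B (c a) (c b) = _
      rw [hBc]; rfl
    · intro i hi j hj
      obtain ⟨b, rfl⟩ := hj
      rw [hBn _ hi, Pi.single_eq_of_ne]
      rintro rfl
      exact hi ⟨b, rfl⟩

end Valuation

/-! ### Coprime fractions -/

section Fractions

variable {K Γ₀ ι : Type*} [Field K] [LinearOrderedCommGroupWithZero Γ₀] [Fintype ι]
  [DecidableEq ι] {v : Valuation K Γ₀}

/-- `D` and `N` are right coprime over the valuation ring of `v`: both are integral and satisfy a
Bézout identity `X * D + Y * N = 1` with integral `X` and `Y`. -/
def RightCoprime (v : Valuation K Γ₀) (D N : Matrix ι ι K) : Prop :=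
  IntegralAt v D ∧ IntegralAt v N ∧
    ∃ X Y, IntegralAt v X ∧ IntegralAt v Y ∧ X * D + Y * N = 1

/-- Every matrix has a right coprime fraction `G = N * D⁻¹`, and the determinant of its denominator
is inverse to `polarSize v G`. -/
theorem exists_rightCoprime (v : Valuation K Γ₀) (G : Matrix ι ι K) :
    ∃ D N, RightCoprime v D N ∧ G * D = N ∧ v D.det * polarSize v G = 1 := by
  -- `B` is an `ι`-rowed submatrix of `[1; G]` whose determinant is largest for `v`; by Cramer's
  -- rule `[1; G] * B⁻¹` is integral, and it contains the rows of `B * B⁻¹ = 1`.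
  obtain ⟨B, hB, hdet⟩ := exists_det_eq_polarSize v G
  have hv0 : v B.det ≠ 0 := by rw [hdet]; exact polarSize_ne_zero G
  have hB0 : B.det ≠ 0 := fun h => hv0 (by rw [h, map_zero])
  have hu : IsUnit B.det := isUnit_iff_ne_zero.2 hB0
  have hbound : ∀ x : K, v x ≤ polarSize v G → v (B.det⁻¹ * x) ≤ 1 := fun x hx => by
    rw [map_mul, map_inv₀, hdet, inv_mul_le_one₀ (zero_lt_iff.2 (polarSize_ne_zero G))]
    exact hx
  have hrow : ∀ (i : ι) (b : ι → K), ((∃ j, b = Pi.single j 1) ∨ ∃ r, b = G r) →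
      v (B.updateRow i b).det ≤ polarSize v G := fun i b hb => by
    refine val_det_le_polarSize G _ fun a => ?_
    by_cases ha : a = i
    · subst ha; rw [Matrix.updateRow_self]; exact hb
    · rw [Matrix.updateRow_ne ha]; exact hB a
  have hD : IntegralAt v B⁻¹ := fun i j => by
    rw [Matrix.inv_def, Matrix.smul_apply, Matrix.adjugate_apply, smul_eq_mul,
      Ring.inverse_eq_inv']
    exact hbound _ (hrow _ _ (.inl ⟨_, rfl⟩))
  have hN : IntegralAt v (G * B⁻¹) := fun i j => by
    have : (G * B⁻¹) i j = B.det⁻¹ * (B.updateRow j (G i)).det := by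
      rw [Matrix.inv_def, Matrix.mul_smul, Matrix.smul_apply, Ring.inverse_eq_inv', smul_eq_mul]
      congr 1
      rw [← Matrix.cramer_transpose_apply, Matrix.cramer_eq_adjugate_mulVec,
        ← Matrix.adjugate_transpose]
      simp only [Matrix.mul_apply, Matrix.mulVec, dotProduct, Matrix.transpose_apply, mul_comm]
    rw [this]
    exact hbound _ (hrow _ _ (.inr ⟨_, rfl⟩))
  classical
  let X : Matrix ι ι K := fun i => if ∃ j, B i = Pi.single j 1 then B i else 0
  let Y : Matrix ι ι K := fun i =>
    if ∃ j, B i = Pi.single j 1 then 0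
    else if h : ∃ r, B i = G r then Pi.single h.choose 1 else 0
  have hXY : X + Y * G = B := by
    ext i j
    rw [Matrix.add_apply, Matrix.mul_apply]
    by_cases h1 : ∃ j, B i = Pi.single j 1
    · simp [X, Y, if_pos h1]
    · have h2 := (hB i).resolve_left h1
      simp only [X, Y, if_neg h1, dif_pos h2, Pi.zero_apply, zero_add, Pi.single_apply, ite_mul,
        one_mul, zero_mul, Finset.sum_ite_eq', Finset.mem_univ, if_true]
      exact (congrFun h2.choose_spec j).symm
  refine ⟨B⁻¹, G * B⁻¹, ⟨hD, hN, X, Y, fun i j => ?_, fun i j => ?_, ?_⟩, rfl, ?_⟩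
  · simp only [X]
    split_ifs with h
    · obtain ⟨l, hl⟩ := h
      rw [hl, Pi.single_apply]; split_ifs <;> simp
    · simp
  · simp only [Y]
    split_ifs with h1 h2
    · simp
    · rw [Pi.single_apply]; split_ifs <;> simp
    · simp
  · rw [← Matrix.mul_assoc, ← Matrix.add_mul, hXY, Matrix.mul_nonsing_inv _ hu]
  · rw [Matrix.det_nonsing_inv, Ring.inverse_eq_inv', map_inv₀, hdet,
      inv_mul_cancel₀ (polarSize_ne_zero G)]

/-- The denominator of any integral fraction of `G`, coprime or not, accounts for all poles. -/
theorem det_mul_polarSize_le {G D N : Matrix ι ι K} (hD : IntegralAt v D) (hN : IntegralAt v N)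
    (h : G * D = N) : v D.det * polarSize v G ≤ 1 := by
  obtain ⟨D₀, N₀, ⟨-, -, X, Y, hX, hY, hXY⟩, hG, hdet⟩ := exists_rightCoprime v G
  -- `X + Y * G` is the inverse of `D₀`, so `D₀⁻¹ * D = X * D + Y * N` is integral
  have h1 : (X + Y * G) * D₀ = 1 := by rw [Matrix.add_mul, Matrix.mul_assoc, hG, hXY]
  have h2 : D = D₀ * (X * D + Y * N) := by
    rw [← h, ← Matrix.mul_assoc Y, ← Matrix.add_mul, ← Matrix.mul_assoc, mul_eq_one_comm.1 h1,
      Matrix.one_mul]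
  rw [h2, Matrix.det_mul, map_mul, mul_right_comm, hdet, one_mul]
  exact ((hX.mul hD).add (hY.mul hN)).det

/-- The determinant of the denominator is the same, up to a unit, for all right coprime fractions:
each denominator is a multiple of the other. -/
theorem RightCoprime.det_mul_polarSize {G D N : Matrix ι ι K} (h : RightCoprime v D N)
    (hG : G * D = N) : v D.det * polarSize v G = 1 := by
  obtain ⟨hD, hN, X, Y, hX, hY, hXY⟩ := h
  refine le_antisymm (det_mul_polarSize_le hD hN hG) ?_
  obtain ⟨D₀, N₀, ⟨hD₀, hN₀, -⟩, hG₀, hdet⟩ := exists_rightCoprime v G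
  have h1 : (X + Y * G) * D = 1 := by rw [Matrix.add_mul, Matrix.mul_assoc, hG, hXY]
  have h2 : D₀ = D * (X * D₀ + Y * N₀) := by
    rw [← hG₀, ← Matrix.mul_assoc Y, ← Matrix.add_mul, ← Matrix.mul_assoc, mul_eq_one_comm.1 h1,
      Matrix.one_mul]
  rw [← hdet]
  refine mul_le_mul_left ?_ _
  rw [h2, Matrix.det_mul, map_mul]
  exact mul_le_of_le_one_right' ((hX.mul hD₀).add (hY.mul hN₀)).det

/-- An integral fraction whose denominator has the least possible determinant is coprime. -/
theorem rightCoprime_of_det_mul_polarSize {G D N : Matrix ι ι K} (hD : IntegralAt v D)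
    (hN : IntegralAt v N) (h : G * D = N) (hdet : v D.det * polarSize v G = 1) :
    RightCoprime v D N := by
  obtain ⟨D₀, N₀, ⟨-, -, X, Y, hX, hY, hXY⟩, hG, hdet₀⟩ := exists_rightCoprime v G
  have h1 : (X + Y * G) * D₀ = 1 := by rw [Matrix.add_mul, Matrix.mul_assoc, hG, hXY]
  have hU := (hX.mul hD).add (hY.mul hN)
  set U := X * D + Y * N with hUdef
  have h2 : D = D₀ * U := by
    rw [hUdef, ← h, ← Matrix.mul_assoc Y, ← Matrix.add_mul, ← Matrix.mul_assoc,
      mul_eq_one_comm.1 h1, Matrix.one_mul]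
  have hU1 : v U.det = 1 := by
    rw [h2, Matrix.det_mul, map_mul, mul_right_comm, hdet₀, one_mul] at hdet
    exact hdet
  have hunit : IsUnit U.det := isUnit_iff_ne_zero.2 fun h0 => by simp [h0] at hU1
  refine ⟨hD, hN, U⁻¹ * X, U⁻¹ * Y, (hU.inv hU1).mul hX, (hU.inv hU1).mul hY, ?_⟩
  rw [Matrix.mul_assoc, Matrix.mul_assoc, ← Matrix.mul_add, ← hUdef, Matrix.nonsing_inv_mul _ hunit]

theorem polarSize_mul_integral_le {G N : Matrix ι ι K} (hN : IntegralAt v N) :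
    polarSize v (G * N) ≤ polarSize v G := by
  obtain ⟨D, M, ⟨hD, hM, -⟩, hG, hdet⟩ := exists_rightCoprime v G.transpose
  rw [polarSize_transpose] at hdet
  have h := det_mul_polarSize_le (G := (G * N).transpose) (D := D) (N := N.transpose * M) hD
    (hN.transpose.mul hM) (by rw [Matrix.transpose_mul, Matrix.mul_assoc, hG])
  rw [polarSize_transpose, ← hdet] at h
  have h0 : v D.det ≠ 0 := fun h0 => by simp [h0] at hdet
  exact (mul_le_mul_iff_right₀ (zero_lt_iff.2 h0)).1 h

/-- The multiplicity of a pole of a product is at most the sum of those of the factors. -/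
theorem polarSize_mul_le (A B : Matrix ι ι K) :
    polarSize v (A * B) ≤ polarSize v A * polarSize v B := by
  obtain ⟨D, N, ⟨hD, hN, -⟩, hB, hdet⟩ := exists_rightCoprime v B
  obtain ⟨D', N', ⟨hD', hN', -⟩, hAN, hdet'⟩ := exists_rightCoprime v (A * N)
  have h := det_mul_polarSize_le (G := A * B) (D := D * D') (N := N') (hD.mul hD') hN'
    (by rw [Matrix.mul_assoc, ← Matrix.mul_assoc B, hB, ← Matrix.mul_assoc, hAN])
  have h0 : v D.det ≠ 0 := fun h0 => by simp [h0] at hdet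
  have h0' : v D'.det ≠ 0 := fun h0 => by simp [h0] at hdet'
  have hB' := eq_inv_of_mul_eq_one_right hdet
  have hA' := eq_inv_of_mul_eq_one_right hdet'
  calc polarSize v (A * B) ≤ (v (D * D').det)⁻¹ := by
        have hpos : 0 < v (D * D').det := by
          rw [Matrix.det_mul, map_mul]; exact zero_lt_iff.2 (mul_ne_zero h0 h0')
        rwa [← one_div, le_div_iff₀' hpos]
    _ = polarSize v (A * N) * polarSize v B := by
        rw [Matrix.det_mul, map_mul, mul_inv, ← hB', ← hA', mul_comm]
    _ ≤ polarSize v A * polarSize v B := mul_le_mul_left (polarSize_mul_integral_le hN) _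

/-- Adding a matrix without a pole does not change the pole multiplicity. -/
theorem polarSize_add_integral {A E : Matrix ι ι K} (hE : IntegralAt v E) :
    polarSize v (A + E) = polarSize v A := by
  obtain ⟨D, N, ⟨hD, hN, X, Y, hX, hY, hXY⟩, hA, hdet⟩ := exists_rightCoprime v A
  have h : RightCoprime v D (N + E * D) :=
    ⟨hD, hN.add (hE.mul hD), X - Y * E, Y, hX.sub (hY.mul hE), hY, by
      rw [← hXY]; noncomm_ring⟩
  have h' := h.det_mul_polarSize (G := A + E) (by rw [Matrix.add_mul, hA])
  have h0 : v D.det ≠ 0 := fun h0 => by simp [h0] at hdet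
  exact mul_left_cancel₀ h0 (h'.trans hdet.symm)

/-! ### Pole multiplicities of feedback loops -/

/-- The poles of the closed loop, in terms of those of its components and of the zeros of the
return difference. -/
theorem det_mul_polarSize_closedLoop {P C : Matrix ι ι K} (h0 : (1 - P * C).det ≠ 0) :
    v (1 - P * C).det * polarSize v (Matrix.fromBlocks 1 (-C) (-P) 1)⁻¹
      = polarSize v P * polarSize v C := by
  obtain ⟨D, N, ⟨hD, hN, X, Y, hX, hY, hXY⟩, hP, hdet⟩ := exists_rightCoprime v P
  obtain ⟨D', N', ⟨hD', hN', X', Y', hX', hY', hXY'⟩, hC, hdet'⟩ := exists_rightCoprime v C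
  set W := Matrix.fromBlocks (1 : Matrix ι ι K) (-C) (-P) 1 with hW
  have hWdet : W.det = (1 - P * C).det := by
    rw [hW, Matrix.det_fromBlocks_one₁₁]; congr 1; noncomm_ring
  have hWD : W * Matrix.fromBlocks D 0 0 D' = Matrix.fromBlocks D (-N') (-N) D' := by
    rw [hW, Matrix.fromBlocks_multiply]
    simp [hP, hC]
  have hcop : RightCoprime v (Matrix.fromBlocks D (-N') (-N) D')
      (Matrix.fromBlocks D 0 0 D') := by
    refine ⟨hD.fromBlocks hN'.neg hN.neg hD', hD.fromBlocks .zero .zero hD',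
      Matrix.fromBlocks 0 (-Y) (-Y') 0, Matrix.fromBlocks X Y Y' X',
      .fromBlocks .zero hY.neg hY'.neg .zero, .fromBlocks hX hY hY' hX', ?_⟩
    rw [Matrix.fromBlocks_multiply, Matrix.fromBlocks_multiply, Matrix.fromBlocks_add,
      ← Matrix.fromBlocks_one]
    rw [← hXY]
    congr 1
    · simp [add_comm]
    · simp
    · simp
    · rw [hXY, ← hXY']; simp [add_comm]
  have h := hcop.det_mul_polarSize (G := W⁻¹) (by
    rw [← hWD, ← Matrix.mul_assoc, Matrix.nonsing_inv_mul _
      (isUnit_iff_ne_zero.2 (by rwa [hWdet])), Matrix.one_mul])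
  rw [← hWD, Matrix.det_mul, hWdet, Matrix.det_fromBlocks_zero₂₁, map_mul, map_mul] at h
  rw [eq_inv_of_mul_eq_one_right hdet, eq_inv_of_mul_eq_one_right hdet', ← mul_inv]
  refine eq_inv_of_mul_eq_one_right ?_
  rw [← h]; ac_rfl

/-- Without pole-zero cancellation, `C * (1 - P * C)⁻¹` alone has all the poles of the closed
loop. -/
theorem det_mul_polarSize_of_no_cancellation {P C : Matrix ι ι K} (h0 : (1 - P * C).det ≠ 0)
    (hPC : polarSize v (P * C) = polarSize v P * polarSize v C)
    (hCP : polarSize v (C * P) = polarSize v C * polarSize v P) :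
    v (1 - P * C).det * polarSize v (C * (1 - P * C)⁻¹) = polarSize v P * polarSize v C := by
  -- a left coprime fraction of `P` and a right coprime fraction of `C`
  obtain ⟨Dt, Nt, ⟨hDt, hNt, -⟩, hPt, hdett⟩ := exists_rightCoprime v P.transpose
  obtain ⟨Dc, Nc, ⟨hDc, hNc, -⟩, hC, hdetc⟩ := exists_rightCoprime v C
  rw [polarSize_transpose] at hdett
  set Dp := Dt.transpose with hDp'
  set Np := Nt.transpose with hNp'
  have hDp : IntegralAt v Dp := hDt.transpose
  have hNp : IntegralAt v Np := hNt.transpose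
  have hP : Dp * P = Np := by rw [hNp', ← hPt, Matrix.transpose_mul, Matrix.transpose_transpose]
  have hdetp : v Dp.det * polarSize v P = 1 := by rwa [hDp', Matrix.det_transpose]
  have hp0 : v Dp.det ≠ 0 := fun h => by simp [h] at hdetp
  have hc0 : v Dc.det ≠ 0 := fun h => by simp [h] at hdetc
  have hup : IsUnit Dp.det := isUnit_iff_ne_zero.2 fun h => hp0 (by rw [h, map_zero])
  have huc : IsUnit Dc.det := isUnit_iff_ne_zero.2 fun h => hc0 (by rw [h, map_zero])
  have hprod : (v Dp.det * v Dc.det) * (polarSize v P * polarSize v C) = 1 := by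
    rw [mul_mul_mul_comm, hdetp, hdetc, one_mul]
  -- `Nc` and `Dp * Dc` are right coprime, as nothing cancels in `C * P = Nc * (Dp * Dc)⁻¹ * Np`
  obtain ⟨-, -, X, Y, hX, hY, hXY⟩ : RightCoprime v (Dp * Dc) Nc := by
    have hH : C * Dp⁻¹ * (Dp * Dc) = Nc := by
      rw [Matrix.mul_assoc, ← Matrix.mul_assoc Dp⁻¹, Matrix.nonsing_inv_mul _ hup, Matrix.one_mul,
        hC]
    refine rightCoprime_of_det_mul_polarSize (hDp.mul hDc) hNc hH
      (le_antisymm (det_mul_polarSize_le (hDp.mul hDc) hNc hH) ?_)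
    rw [← hprod, Matrix.det_mul, map_mul]
    refine mul_le_mul_right ?_ _
    rw [mul_comm, ← hCP]
    have : C * P = C * Dp⁻¹ * Np := by
      rw [← hP, Matrix.mul_assoc, ← Matrix.mul_assoc Dp⁻¹, Matrix.nonsing_inv_mul _ hup,
        Matrix.one_mul]
    rw [this]
    exact polarSize_mul_integral_le hNp
  -- `Dp` and `Np * Nc` are left coprime, as nothing cancels in `P * C = Dp⁻¹ * (Np * Nc) * Dc⁻¹`
  obtain ⟨-, -, X', Y', hX', hY', hXY'⟩ : RightCoprime v Dt (Np * Nc).transpose := by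
    have hH : (P * Nc).transpose * Dt = (Np * Nc).transpose := by
      rw [← hP, Matrix.mul_assoc, Matrix.transpose_mul Dp, hDp', Matrix.transpose_transpose]
    refine rightCoprime_of_det_mul_polarSize hDt (hNp.mul hNc).transpose hH
      (le_antisymm (det_mul_polarSize_le hDt (hNp.mul hNc).transpose hH) ?_)
    rw [polarSize_transpose, ← hdett]
    refine mul_le_mul_right ?_ _
    have h1 : polarSize v (P * C) ≤ polarSize v (P * Nc) * polarSize v C := by
      have h2 : P * C = P * Nc * Dc⁻¹ := by
        rw [← hC, Matrix.mul_assoc, Matrix.mul_assoc, Matrix.mul_nonsing_inv _ huc, Matrix.mul_one]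
      have h3 : polarSize v Dc⁻¹ ≤ polarSize v C := by
        have h4 := det_mul_polarSize_le (G := Dc⁻¹) hDc .one (Matrix.nonsing_inv_mul _ huc)
        rw [← hdetc] at h4
        exact (mul_le_mul_iff_right₀ (zero_lt_iff.2 hc0)).1 h4
      rw [h2]
      exact (polarSize_mul_le _ _).trans (mul_le_mul_right h3 _)
    rw [hPC] at h1
    exact (mul_le_mul_iff_left₀ (zero_lt_iff.2 (polarSize_ne_zero C))).1 h1
  -- `C * (1 - P * C)⁻¹ = Nc * Z⁻¹ * Dp`, where `Nc, Z` are right and `Z, Dp` left coprime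
  set Z := Dp * Dc - Np * Nc with hZ'
  have hZ : IntegralAt v Z := (hDp.mul hDc).sub (hNp.mul hNc)
  have hZfac : Z = Dp * (1 - P * C) * Dc := by
    rw [hZ', ← hP, ← hC]; noncomm_ring
  have hZdet : v Z.det = v (1 - P * C).det * (v Dp.det * v Dc.det) := by
    rw [hZfac, Matrix.det_mul, Matrix.det_mul, map_mul, map_mul]; ac_rfl
  have huR : IsUnit (1 - P * C).det := isUnit_iff_ne_zero.2 h0
  have huZ : IsUnit Z.det := by
    rw [hZfac, Matrix.det_mul, Matrix.det_mul]; exact (hup.mul huR).mul huc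
  have hleft : v Z.det * polarSize v (Z⁻¹ * Dp) = 1 := by
    rw [← polarSize_transpose, ← Matrix.det_transpose]
    refine RightCoprime.det_mul_polarSize (N := Dt)
      ⟨hZ.transpose, hDt, -Y', X' + Y' * Dc.transpose, hY'.neg, hX'.add (hY'.mul hDc.transpose),
        ?_⟩ ?_
    · rw [← hXY', hZ', Matrix.transpose_sub, Matrix.transpose_mul Dp, hDp',
        Matrix.transpose_transpose]
      noncomm_ring
    · rw [← Matrix.transpose_mul, ← Matrix.mul_assoc, Matrix.mul_nonsing_inv _ huZ, Matrix.one_mul,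
        hDp', Matrix.transpose_transpose]
  -- a right coprime fraction of `Z⁻¹ * Dp` stays coprime when its numerator is multiplied by `Nc`
  obtain ⟨D, N, ⟨hD, hN, X₃, Y₃, hX₃, hY₃, hXY₃⟩, hG, hdet⟩ := exists_rightCoprime v (Z⁻¹ * Dp)
  have hZN : Z * N = Dp * D := by
    rw [← hG, ← Matrix.mul_assoc, ← Matrix.mul_assoc, Matrix.mul_nonsing_inv _ huZ, Matrix.one_mul]
  have hN' : (X * Dp) * D + (X * Np + Y) * (Nc * N) = N := by
    calc _ = X * (Dp * D) + (X * Np + Y) * (Nc * N) := by rw [Matrix.mul_assoc]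
      _ = (X * (Dp * Dc) + Y * Nc) * N := by rw [← hZN, hZ']; noncomm_ring
      _ = N := by rw [hXY, Matrix.one_mul]
  have hcop : RightCoprime v D (Nc * N) := by
    refine ⟨hD, hNc.mul hN, X₃ + Y₃ * (X * Dp), Y₃ * (X * Np + Y),
      hX₃.add (hY₃.mul (hX.mul hDp)), hY₃.mul ((hX.mul hNp).add hY), ?_⟩
    calc _ = X₃ * D + Y₃ * ((X * Dp) * D + (X * Np + Y) * (Nc * N)) := by noncomm_ring
      _ = 1 := by rw [hN', hXY₃]
  have hGeq : C * (1 - P * C)⁻¹ = Nc * (Z⁻¹ * Dp) := by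
    rw [hZfac, Matrix.mul_inv_rev, Matrix.mul_inv_rev, ← hC]
    simp only [Matrix.mul_assoc]
    rw [Matrix.nonsing_inv_mul _ hup, Matrix.mul_one, ← Matrix.mul_assoc Dc,
      Matrix.mul_nonsing_inv _ huc, Matrix.one_mul]
  have hfin := hcop.det_mul_polarSize (G := Nc * (Z⁻¹ * Dp)) (by rw [Matrix.mul_assoc, hG])
  have hd0 : v D.det ≠ 0 := fun h => by simp [h] at hdet
  rw [hGeq, mul_left_cancel₀ hd0 (hfin.trans hdet.symm)]
  rw [hZdet] at hleft
  have h1 := mul_right_comm (v (1 - P * C).det) (v Dp.det * v Dc.det) (polarSize v (Z⁻¹ * Dp))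
  rw [hleft] at h1
  rw [eq_inv_of_mul_eq_one_left h1.symm, eq_inv_of_mul_eq_one_right hprod]

end Fractions

/-! ### Valuations of real-rational functions at complex points -/

section Places

open Polynomial WithZero

noncomputable section

/-- The multiplicity of the complex number `s` as a zero of a real polynomial. -/
def zeroMult (s : ℂ) (p : ℝ[X]) : ℕ := (p.map (algebraMap ℝ ℂ)).rootMultiplicity s

theorem map_complex_ne_zero {p : ℝ[X]} (hp : p ≠ 0) : p.map (algebraMap ℝ ℂ) ≠ 0 :=
  (Polynomial.map_ne_zero_iff (algebraMap ℝ ℂ).injective).2 hp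

theorem zeroMult_mul (s : ℂ) {p q : ℝ[X]} (hp : p ≠ 0) (hq : q ≠ 0) :
    zeroMult s (p * q) = zeroMult s p + zeroMult s q := by
  rw [zeroMult, Polynomial.map_mul, rootMultiplicity_mul
    (mul_ne_zero (map_complex_ne_zero hp) (map_complex_ne_zero hq))]
  rfl

theorem zeroMult_eq_zero_iff (s : ℂ) {p : ℝ[X]} (hp : p ≠ 0) :
    zeroMult s p = 0 ↔ p.eval₂ (algebraMap ℝ ℂ) s ≠ 0 := by
  rw [zeroMult, rootMultiplicity_eq_zero_iff, IsRoot.def, eval_map]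
  simp [map_complex_ne_zero hp]

theorem zeroMult_num_eq_zero_or_denom (s : ℂ) (f : RatFunc ℝ) :
    zeroMult s f.num = 0 ∨ zeroMult s f.denom = 0 := by
  by_contra! h
  have hf : f.num ≠ 0 := fun h0 => h.1 (by simp [h0, zeroMult])
  rw [Ne, Ne, zeroMult_eq_zero_iff s hf, zeroMult_eq_zero_iff s f.denom_ne_zero, not_not,
    not_not] at h
  obtain ⟨a, b, hab⟩ := f.isCoprime_num_denom
  have := congrArg (Polynomial.eval₂ (algebraMap ℝ ℂ) s) hab
  simp [Polynomial.eval₂_add, Polynomial.eval₂_mul, h.1, h.2] at this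

/-- The order of vanishing at `s` of a rational function. -/
def ordAt (s : ℂ) (f : RatFunc ℝ) : ℤ := zeroMult s f.num - zeroMult s f.denom

theorem ordAt_div (s : ℂ) {p q : ℝ[X]} (hp : p ≠ 0) (hq : q ≠ 0) :
    ordAt s (algebraMap _ _ p / algebraMap _ _ q) = zeroMult s p - zeroMult s q := by
  set f : RatFunc ℝ := algebraMap _ _ p / algebraMap _ _ q with hf
  have hp' : algebraMap ℝ[X] (RatFunc ℝ) p ≠ 0 := RatFunc.algebraMap_ne_zero hp
  have hq' : algebraMap ℝ[X] (RatFunc ℝ) q ≠ 0 := RatFunc.algebraMap_ne_zero hq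
  have hf0 : f ≠ 0 := div_ne_zero hp' hq'
  have h : f.num * q = p * f.denom := by
    apply RatFunc.algebraMap_injective (K := ℝ)
    rw [map_mul, map_mul, ← div_eq_div_iff (RatFunc.algebraMap_ne_zero f.denom_ne_zero) hq',
      RatFunc.num_div_denom]
  have h1 := congrArg (zeroMult s) h
  rw [zeroMult_mul s (RatFunc.num_ne_zero hf0) hq, zeroMult_mul s hp f.denom_ne_zero] at h1
  rw [ordAt]
  omega

theorem exists_eq_div {f : RatFunc ℝ} (hf : f ≠ 0) :
    ∃ p q : ℝ[X], p ≠ 0 ∧ q ≠ 0 ∧ f = algebraMap _ _ p / algebraMap _ _ q :=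
  ⟨f.num, f.denom, RatFunc.num_ne_zero hf, f.denom_ne_zero, (RatFunc.num_div_denom f).symm⟩

theorem ordAt_mul (s : ℂ) {f g : RatFunc ℝ} (hf : f ≠ 0) (hg : g ≠ 0) :
    ordAt s (f * g) = ordAt s f + ordAt s g := by
  obtain ⟨p, q, hp, hq, rfl⟩ := exists_eq_div hf
  obtain ⟨p', q', hp', hq', rfl⟩ := exists_eq_div hg
  rw [div_mul_div_comm, ← map_mul, ← map_mul, ordAt_div s (mul_ne_zero hp hp') (mul_ne_zero hq hq'),
    ordAt_div s hp hq, ordAt_div s hp' hq', zeroMult_mul s hp hp', zeroMult_mul s hq hq']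
  push_cast; ring

theorem min_ordAt_le_ordAt_add (s : ℂ) {f g : RatFunc ℝ} (hf : f ≠ 0) (hg : g ≠ 0)
    (hfg : f + g ≠ 0) : min (ordAt s f) (ordAt s g) ≤ ordAt s (f + g) := by
  obtain ⟨p, q, hp, hq, rfl⟩ := exists_eq_div hf
  obtain ⟨p', q', hp', hq', rfl⟩ := exists_eq_div hg
  have hsum : algebraMap ℝ[X] (RatFunc ℝ) p / algebraMap _ _ q +
      algebraMap _ _ p' / algebraMap _ _ q' =
        algebraMap _ _ (p * q' + q * p') / algebraMap _ _ (q * q') := by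
    rw [div_add_div _ _ (RatFunc.algebraMap_ne_zero hq) (RatFunc.algebraMap_ne_zero hq')]
    simp only [map_mul, map_add]
  have hnum : p * q' + q * p' ≠ 0 := fun h0 => hfg (by rw [hsum, h0, map_zero, zero_div])
  rw [hsum, ordAt_div s hnum (mul_ne_zero hq hq'), ordAt_div s hp hq, ordAt_div s hp' hq',
    zeroMult_mul s hq hq']
  have h := rootMultiplicity_add (p := (p * q').map (algebraMap ℝ ℂ))
    (q := (q * p').map (algebraMap ℝ ℂ)) s
    (by rw [← Polynomial.map_add]; exact map_complex_ne_zero hnum)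
  rw [← Polynomial.map_add] at h
  change min (zeroMult s (p * q')) (zeroMult s (q * p')) ≤ zeroMult s (p * q' + q * p') at h
  rw [zeroMult_mul s hp hq', zeroMult_mul s hq hp'] at h
  omega

open Classical in
/-- The valuation of the field of real-rational functions given by the order of vanishing at a
complex number. -/
def valAt (s : ℂ) : Valuation (RatFunc ℝ) ℤᵐ⁰ where
  toFun f := if f = 0 then 0 else exp (-ordAt s f)
  map_zero' := if_pos rfl
  map_one' := by
    rw [if_neg one_ne_zero, ordAt, RatFunc.num_one, RatFunc.denom_one, sub_self, neg_zero, exp_zero]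
  map_mul' f g := by
    by_cases hf : f = 0
    · simp [hf]
    by_cases hg : g = 0
    · simp [hg]
    rw [if_neg hf, if_neg hg, if_neg (mul_ne_zero hf hg), ordAt_mul s hf hg, neg_add, exp_add]
  map_add_le_max' f g := by
    by_cases hfg : f + g = 0
    · rw [if_pos hfg]; exact zero_le
    by_cases hf : f = 0
    · simp [hf]
    by_cases hg : g = 0
    · simp [hg]
    rw [if_neg hf, if_neg hg, if_neg hfg, le_max_iff, exp_le_exp, exp_le_exp]
    have := min_ordAt_le_ordAt_add s hf hg hfg
    omega

theorem valAt_of_ne_zero (s : ℂ) {f : RatFunc ℝ} (hf : f ≠ 0) :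
    valAt s f = exp (-ordAt s f) := if_neg hf

theorem valAt_algebraMap (s : ℂ) {p : ℝ[X]} (hp : p ≠ 0) :
    valAt s (algebraMap _ _ p) = exp (-(zeroMult s p : ℤ)) := by
  rw [valAt_of_ne_zero s (RatFunc.algebraMap_ne_zero hp), ordAt, RatFunc.num_algebraMap,
    RatFunc.denom_algebraMap]
  simp [zeroMult, rootMultiplicity_eq_zero]

theorem valAt_le_one_iff (s : ℂ) (f : RatFunc ℝ) :
    valAt s f ≤ 1 ↔ f.denom.eval₂ (algebraMap ℝ ℂ) s ≠ 0 := by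
  rw [← zeroMult_eq_zero_iff s f.denom_ne_zero]
  by_cases hf : f = 0
  · simp [hf, zeroMult, rootMultiplicity_eq_zero]
  · rw [valAt_of_ne_zero s hf, ← exp_zero, exp_le_exp, ordAt]
    have := zeroMult_num_eq_zero_or_denom s f
    omega

theorem valAt_eq_one_of_eval_ne_zero (s : ℂ) {f : RatFunc ℝ}
    (h : f.eval (algebraMap ℝ ℂ) s ≠ 0) : valAt s f = 1 := by
  have hd := RatFunc.eval₂_denom_ne_zero h
  have hn : f.num.eval₂ (algebraMap ℝ ℂ) s ≠ 0 := fun h0 => h (by rw [RatFunc.eval, h0, zero_div])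
  have hf : f ≠ 0 := by rintro rfl; simp at h
  rw [← zeroMult_eq_zero_iff s f.denom_ne_zero] at hd
  rw [← zeroMult_eq_zero_iff s (RatFunc.num_ne_zero hf)] at hn
  rw [valAt_of_ne_zero s hf, ordAt, hn, hd]; simp

theorem valAt_le_exp_zeroMult_denom (s : ℂ) (f : RatFunc ℝ) :
    valAt s f ≤ exp (zeroMult s f.denom : ℤ) := by
  by_cases hf : f = 0
  · simp [hf]
  · rw [valAt_of_ne_zero s hf, exp_le_exp, ordAt]; omega

theorem valAt_eq_exp_zeroMult_denom (s : ℂ) {f : RatFunc ℝ} (h : zeroMult s f.denom ≠ 0) :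
    valAt s f = exp (zeroMult s f.denom : ℤ) := by
  have hf : f ≠ 0 := by rintro rfl; simp [zeroMult, rootMultiplicity_eq_zero] at h
  rw [valAt_of_ne_zero s hf, ordAt, (zeroMult_num_eq_zero_or_denom s f).resolve_right h]
  simp

open Classical in
/-- The multiplicities of the poles are the largest pole orders of the minors. -/
theorem polarSize_valAt {ι : Type*} [Fintype ι] (s : ℂ) (G : Matrix ι ι (RatFunc ℝ)) :
    polarSize (valAt s) G = exp (((poles G).count s : ℕ) : ℤ) := by
  have hcount : (poles G).count s = Finset.univ.sup fun x => zeroMult s (minor G x).denom := by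
    rw [poles, Multiset.count_finset_sup]
    simp only [aroots, count_roots, zeroMult]
  have hle : ∀ x, zeroMult s (minor G x).denom ≤ (poles G).count s := fun x => by
    rw [hcount]
    exact Finset.le_sup (f := fun x => zeroMult s (minor G x).denom) (Finset.mem_univ x)
  refine le_antisymm ?_ ?_
  · refine Finset.sup'_le _ _ fun x _ => (valAt_le_exp_zeroMult_denom s (minor G x)).trans ?_
    exact exp_le_exp.2 (by exact_mod_cast hle x)
  · by_cases h0 : (poles G).count s = 0
    · rw [h0]; simpa using one_le_polarSize G
    · obtain ⟨x, -, hx⟩ := Finset.exists_mem_eq_sup Finset.univ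
        ⟨(⟨0, Fin.elim0, Fin.elim0⟩ : Σ k : Fin (Fintype.card ι + 1), (Fin k → ι) × (Fin k → ι)),
          Finset.mem_univ _⟩ fun x => zeroMult s (minor G x).denom
      rw [hcount, hx, ← valAt_eq_exp_zeroMult_denom s (by rwa [← hx, ← hcount])]
      exact minor_le_polarSize G (Nat.le_of_lt_succ x.1.2) x.2.1 x.2.2

theorem polarSize_valAt_eq_one_iff {ι : Type*} [Fintype ι] (s : ℂ) (G : Matrix ι ι (RatFunc ℝ)) :
    polarSize (valAt s) G = 1 ↔ s ∉ poles G := by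
  classical
  rw [polarSize_valAt, exp_eq_one, Nat.cast_eq_zero, Multiset.count_eq_zero]

theorem integralAt_of_polarSize {K Γ₀ ι : Type*} [Field K] [LinearOrderedCommGroupWithZero Γ₀]
    [Fintype ι] {v : Valuation K Γ₀} {G : Matrix ι ι K} (h : polarSize v G = 1) :
    IntegralAt v G := fun i j => by
  have h1 := minor_le_polarSize (v := v) G (k := 1) (Fintype.card_pos_iff.2 ⟨i⟩)
    (fun _ => i) (fun _ => j)
  rw [h] at h1
  simpa using h1

theorem integralAt_valAt {ι : Type*} [Fintype ι] {s : ℂ} {G : Matrix ι ι (RatFunc ℝ)}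
    (h : s ∉ poles G) : IntegralAt (valAt s) G :=
  integralAt_of_polarSize ((polarSize_valAt_eq_one_iff s G).2 h)

/-! ### Residue maps -/

/-- `ev` is a residue map of the valuation `v`: multiplicative and additive on the valuation ring,
and nonzero only on elements that are not in the maximal ideal. -/
structure IsResidueMap {K Γ₀ F : Type*} [Field K] [LinearOrderedCommGroupWithZero Γ₀] [Field F]
    (v : Valuation K Γ₀) (ev : K → F) : Prop where
  map_zero : ev 0 = 0
  map_one : ev 1 = 1
  map_add : ∀ {x y}, v x ≤ 1 → v y ≤ 1 → ev (x + y) = ev x + ev y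
  map_mul : ∀ {x y}, v x ≤ 1 → v y ≤ 1 → ev (x * y) = ev x * ev y
  val_eq_one : ∀ {x}, v x ≤ 1 → ev x ≠ 0 → v x = 1

namespace IsResidueMap

variable {K Γ₀ F : Type*} [Field K] [LinearOrderedCommGroupWithZero Γ₀] [Field F]
  {v : Valuation K Γ₀} {ev : K → F} (h : IsResidueMap v ev) {n : Type*}

/-- The restriction of a residue map to the valuation ring, as a ring homomorphism. -/
def toRingHom (h : IsResidueMap v ev) : v.integer →+* F where
  toFun x := ev x
  map_zero' := h.map_zero
  map_one' := h.map_one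
  map_add' x y := h.map_add x.2 y.2
  map_mul' x y := h.map_mul x.2 y.2

theorem exists_lift {A : Matrix n n K} (hA : IntegralAt v A) :
    ∃ A' : Matrix n n v.integer, A'.map v.integer.subtype = A :=
  ⟨Matrix.of fun i j => ⟨A i j, hA i j⟩, rfl⟩

theorem matrix_map (A : Matrix n n v.integer) :
    (A.map v.integer.subtype).map ev = A.map h.toRingHom := rfl

include h

theorem map_matrix_mul [Fintype n] {A B : Matrix n n K} (hA : IntegralAt v A)
    (hB : IntegralAt v B) :
    (A * B).map ev = A.map ev * B.map ev := by
  obtain ⟨A, rfl⟩ := exists_lift hA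
  obtain ⟨B, rfl⟩ := exists_lift hB
  rw [← Matrix.map_mul, h.matrix_map, h.matrix_map, h.matrix_map, Matrix.map_mul]

theorem map_matrix_sub {A B : Matrix n n K} (hA : IntegralAt v A) (hB : IntegralAt v B) :
    (A - B).map ev = A.map ev - B.map ev := by
  obtain ⟨A, rfl⟩ := exists_lift hA
  obtain ⟨B, rfl⟩ := exists_lift hB
  rw [← Matrix.map_sub _ (map_sub _), h.matrix_map, h.matrix_map, h.matrix_map,
    Matrix.map_sub _ (map_sub _)]

theorem map_matrix_one [DecidableEq n] : (1 : Matrix n n K).map ev = 1 :=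
  Matrix.map_one _ h.map_zero h.map_one

theorem map_det [Fintype n] [DecidableEq n] {A : Matrix n n K} (hA : IntegralAt v A) :
    ev A.det = (A.map ev).det := by
  obtain ⟨A, rfl⟩ := exists_lift hA
  rw [h.matrix_map]
  have h1 := RingHom.map_det v.integer.subtype A
  have h2 := RingHom.map_det h.toRingHom A
  rw [RingHom.mapMatrix_apply] at h1 h2
  rw [← h1, ← h2]; rfl

theorem val_det_eq_one [Fintype n] [DecidableEq n] {A : Matrix n n K} (hA : IntegralAt v A)
    (hdet : (A.map ev).det ≠ 0) : v A.det = 1 :=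
  h.val_eq_one hA.det (by rwa [h.map_det hA])

end IsResidueMap

theorem isResidueMap_eval (s : ℂ) :
    IsResidueMap (valAt s) (RatFunc.eval (algebraMap ℝ ℂ) s) where
  map_zero := RatFunc.eval_zero _ _
  map_one := RatFunc.eval_one _ _
  map_add hx hy := RatFunc.eval_add _ _ ((valAt_le_one_iff s _).1 hx) ((valAt_le_one_iff s _).1 hy)
  map_mul hx hy := RatFunc.eval_mul _ _ ((valAt_le_one_iff s _).1 hx) ((valAt_le_one_iff s _).1 hy)
  val_eq_one _ hx := valAt_eq_one_of_eval_ne_zero s hx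

open Classical in
theorem inftyValuation_le_one_iff (f : RatFunc ℝ) :
    RatFunc.inftyValuation ℝ f ≤ 1 ↔ f.num.natDegree ≤ f.denom.natDegree := by
  by_cases hf : f = 0
  · simp [hf]
  · rw [RatFunc.inftyValuation_apply, RatFunc.inftyValuation_of_nonzero ℝ hf, ← exp_zero,
      exp_le_exp, RatFunc.intDegree]
    omega

/-- The value at infinity may be read off any fraction with a denominator of the stated degree. -/
theorem valueAtInfty_div {p q : ℝ[X]} (hq : q ≠ 0) {f : RatFunc ℝ}
    (hf : f = algebraMap _ _ p / algebraMap _ _ q) (hp : p.natDegree ≤ q.natDegree)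
    (hfp : f.num.natDegree ≤ f.denom.natDegree) :
    valueAtInfty f = p.coeff q.natDegree / q.leadingCoeff := by
  have hq' : algebraMap ℝ[X] (RatFunc ℝ) q ≠ 0 := RatFunc.algebraMap_ne_zero hq
  have h : f.num * q = p * f.denom := by
    apply RatFunc.algebraMap_injective (K := ℝ)
    rw [map_mul, map_mul, ← div_eq_div_iff (RatFunc.algebraMap_ne_zero f.denom_ne_zero) hq',
      RatFunc.num_div_denom, hf]
  have h1 := congrArg (fun r => r.coeff (f.denom.natDegree + q.natDegree)) h
  rw [coeff_mul_add_eq_of_natDegree_le hfp le_rfl, add_comm,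
    coeff_mul_add_eq_of_natDegree_le hp le_rfl] at h1
  rw [valueAtInfty, div_eq_div_iff (leadingCoeff_ne_zero.2 f.denom_ne_zero)
    (leadingCoeff_ne_zero.2 hq)]
  exact h1

open Classical in
theorem isResidueMap_valueAtInfty :
    IsResidueMap (RatFunc.inftyValuation ℝ) valueAtInfty where
  map_zero := by simp [valueAtInfty]
  map_one := by simp [valueAtInfty]
  map_add {x y} hx hy := by
    have hxy := (RatFunc.inftyValuation ℝ).map_add_le hx hy
    rw [inftyValuation_le_one_iff] at hx hy hxy
    have hd := mul_ne_zero x.denom_ne_zero y.denom_ne_zero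
    have hdeg := natDegree_mul x.denom_ne_zero y.denom_ne_zero
    rw [valueAtInfty_div (p := x.num * y.denom + x.denom * y.num) hd _ _ hxy, hdeg, coeff_add,
      coeff_mul_add_eq_of_natDegree_le hx le_rfl, coeff_mul_add_eq_of_natDegree_le le_rfl hy,
      leadingCoeff_mul,
      valueAtInfty, valueAtInfty, div_add_div _ _ (leadingCoeff_ne_zero.2 x.denom_ne_zero)
        (leadingCoeff_ne_zero.2 y.denom_ne_zero)]
    · rfl
    · rw [map_add, map_mul, map_mul, map_mul, ← div_add_div _ _
        (RatFunc.algebraMap_ne_zero x.denom_ne_zero) (RatFunc.algebraMap_ne_zero y.denom_ne_zero),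
        RatFunc.num_div_denom, RatFunc.num_div_denom]
    · rw [hdeg]
      exact natDegree_add_le_of_degree_le (natDegree_mul_le_of_le hx le_rfl)
        (natDegree_mul_le_of_le le_rfl hy)
  map_mul {x y} hx hy := by
    have hxy : RatFunc.inftyValuation ℝ (x * y) ≤ 1 := by
      rw [map_mul]; exact mul_le_one' hx hy
    rw [inftyValuation_le_one_iff] at hx hy hxy
    have hd := mul_ne_zero x.denom_ne_zero y.denom_ne_zero
    have hdeg := natDegree_mul x.denom_ne_zero y.denom_ne_zero
    rw [valueAtInfty_div (p := x.num * y.num) hd _ _ hxy, hdeg,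
      coeff_mul_add_eq_of_natDegree_le hx hy, leadingCoeff_mul, valueAtInfty, valueAtInfty,
      div_mul_div_comm]
    · rw [map_mul, map_mul, ← div_mul_div_comm, RatFunc.num_div_denom, RatFunc.num_div_denom]
    · rw [hdeg]
      exact natDegree_mul_le_of_le hx hy
  val_eq_one {x} hx h := by
    rw [inftyValuation_le_one_iff] at hx
    have h1 : x.num.coeff x.denom.natDegree ≠ 0 := fun h0 => h (by rw [valueAtInfty, h0, zero_div])
    have h2 := le_antisymm hx (le_natDegree_of_ne_zero h1)
    have hx0 : x ≠ 0 := by rintro rfl; simp at h1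
    rw [RatFunc.inftyValuation_apply, RatFunc.inftyValuation_of_nonzero ℝ hx0, RatFunc.intDegree,
      h2, sub_self, exp_zero]

end

end Places

/-! ### Root counting by continuity -/

section RootHomotopy

open Polynomial

open Classical in
/-- The parameters at which a given number of roots lie in a closed set form a closed set: they are
the projection of the compact set of pairs of a parameter and an ordered factorization. -/
theorem isClosed_le_countP_roots {T : Type*} [TopologicalSpace T] [CompactSpace T] [T2Space T]
    {q : T → ℂ[X]} {n : ℕ} (hdeg : ∀ t, (q t).natDegree = n) (hne : ∀ t, q t ≠ 0)
    (hcont : ∀ k, Continuous fun t => (q t).coeff k) {H : Set ℂ} (hH : IsClosed H) (k : ℕ)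
    (hk : k ≤ n) : IsClosed {t | k ≤ (q t).roots.countP (· ∈ H)} := by
  have hlc : ∀ t, (q t).coeff n ≠ 0 := fun t => by
    rw [← hdeg t]; exact leadingCoeff_ne_zero.2 (hne t)
  let Z : Set (T × (Fin n → ℂ)) :=
    {x | (∀ w, (q x.1).eval w = (q x.1).coeff n * ∏ i, (w - x.2 i)) ∧
      ∀ i : Fin n, (i : ℕ) < k → x.2 i ∈ H}
  have heval : ∀ w, Continuous fun t => (q t).eval w := fun w => by
    have : (fun t => (q t).eval w) = fun t =>
        ∑ i ∈ Finset.range (n + 1), (q t).coeff i * w ^ i := by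
      funext t; rw [eval_eq_sum_range, hdeg]
    rw [this]
    exact continuous_finsetSum _ fun i _ => (hcont i).mul continuous_const
  have hZclosed : IsClosed Z := by
    refine IsClosed.inter (s₁ := {x : T × (Fin n → ℂ) | ∀ w, (q x.1).eval w =
      (q x.1).coeff n * ∏ i, (w - x.2 i)}) (s₂ := {x | ∀ i : Fin n, (i : ℕ) < k → x.2 i ∈ H}) ?_ ?_
    · simp only [Set.ofPred_forall]
      refine isClosed_iInter fun w => isClosed_eq ((heval w).comp continuous_fst) ?_
      exact ((hcont n).comp continuous_fst).mul (by fun_prop)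
    · simp only [Set.ofPred_forall]
      exact isClosed_iInter fun i => isClosed_iInter fun _ => hH.preimage (by fun_prop)
  -- a uniform bound for the roots
  have hbound : ∃ R : ℝ, ∀ t w, (q t).eval w = 0 → ‖w‖ ≤ R := by
    have hb : ∀ i, ∃ R : ℝ, ∀ t, ‖(q t).coeff i / (q t).coeff n‖ ≤ R := fun i => by
      obtain ⟨R, hR⟩ := isCompact_univ.exists_bound_of_continuousOn
        (((hcont i).div (hcont n) hlc).continuousOn (s := Set.univ))
      exact ⟨R, fun t => hR t trivial⟩
    choose R hR using hb
    refine ⟨∑ i ∈ Finset.range n, |R i| + 1, fun t w hw => ?_⟩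
    have h1 := IsRoot.norm_lt_cauchyBound (hne t) hw
    refine (NNReal.coe_le_coe.2 h1.le).trans ?_
    rw [cauchyBound, NNReal.coe_add, NNReal.coe_div, hdeg, NNReal.coe_one]
    refine add_le_add_left ?_ _
    have hle : (Finset.range n).sup (fun i => ‖(q t).coeff i‖₊) / ‖(q t).leadingCoeff‖₊
        ≤ ∑ i ∈ Finset.range n, ‖R i‖₊ := by
      have hpos : 0 < ‖(q t).leadingCoeff‖₊ := nnnorm_pos.2 (leadingCoeff_ne_zero.2 (hne t))
      rw [div_le_iff₀ hpos]
      refine Finset.sup_le fun i hi => ?_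
      rw [← div_le_iff₀ hpos, ← nnnorm_div]
      refine le_trans ?_ (Finset.single_le_sum (f := fun i => ‖R i‖₊) (fun _ _ => zero_le) hi)
      rw [← NNReal.coe_le_coe, coe_nnnorm, coe_nnnorm, leadingCoeff, hdeg]
      exact (hR i t).trans (le_abs_self _)
    have := NNReal.coe_le_coe.2 hle
    push_cast at this
    simpa using this
  obtain ⟨R, hR⟩ := hbound
  have hZcompact : IsCompact Z := by
    refine IsCompact.of_isClosed_subset (isCompact_univ.prod
      (isCompact_univ_pi fun _ : Fin n => isCompact_closedBall (0 : ℂ) R)) hZclosed ?_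
    rintro ⟨t, z⟩ ⟨h1, -⟩
    refine ⟨trivial, fun i _ => ?_⟩
    rw [mem_closedBall_zero_iff]
    refine hR t _ ?_
    rw [h1, Finset.prod_eq_zero (Finset.mem_univ i) (sub_self _), mul_zero]
  have himage : {t | k ≤ (q t).roots.countP (· ∈ H)} = Prod.fst '' Z := by
    ext t
    constructor
    · intro ht
      -- list the roots in `H` first
      let L := ((q t).roots.filter (· ∈ H)).toList ++ ((q t).roots.filter (¬ · ∈ H)).toList
      have hL : (L : Multiset ℂ) = (q t).roots := by
        rw [← Multiset.coe_add, Multiset.coe_toList, Multiset.coe_toList, Multiset.filter_add_not]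
      have hsplit := IsAlgClosed.splits (q t)
      have hlen : L.length = n := by
        rw [← hdeg t, hsplit.natDegree_eq_card_roots, ← hL, Multiset.coe_card]
      refine ⟨(t, fun i => L.get (i.cast hlen.symm)), ⟨fun w => ?_, fun i hi => ?_⟩, rfl⟩
      · simp only
        rw [hsplit.eval_eq_prod_roots, leadingCoeff, hdeg, ← hL, Multiset.map_coe,
          Multiset.prod_coe, ← List.prod_ofFn]
        congr 2
        refine List.ext_get (by simp [hlen]) fun a _ _ => by simp
      · have hi' : (i : ℕ) < ((q t).roots.filter (· ∈ H)).toList.length := by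
          rw [Multiset.length_toList, ← Multiset.countP_eq_card_filter]
          exact hi.trans_le ht
        change L[(i : ℕ)]'_ ∈ H
        rw [List.getElem_append_left hi']
        have := List.getElem_mem hi'
        rw [Multiset.mem_toList, Multiset.mem_filter] at this
        exact this.2
    · rintro ⟨⟨t, z⟩, ⟨h1, h2⟩, rfl⟩
      have hq : q t = C ((q t).coeff n) * ∏ i, (X - C (z i)) := by
        refine funext fun w => ?_
        rw [h1 w, eval_mul, eval_C, eval_prod]
        simp
      have hroots : (q t).roots = Finset.univ.val.map z := by
        rw [hq, roots_C_mul _ (hlc t)]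
        exact roots_multiset_prod_X_sub_C (Finset.univ.val.map z) ▸ by
          rw [Multiset.map_map]; rfl
      simp only [Set.mem_ofPred_eq]
      rw [hroots, Multiset.countP_map]
      have : k = (Finset.univ.filter fun i : Fin n => (i : ℕ) < k).card := by
        rw [Fin.card_filter_val_lt, min_eq_right hk]
      rw [this]
      exact Finset.card_le_card (s := Finset.univ.filter fun i : Fin n => (i : ℕ) < k)
        (t := Finset.univ.filter fun i => z i ∈ H)
        (Finset.monotone_filter_right _ fun i _ hi => h2 i hi)
  rw [himage]
  exact (hZcompact.image continuous_fst).isClosed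

open Classical in
/-- In a family of polynomials of fixed degree without imaginary roots, the number of roots in the
open right half-plane is constant. -/
theorem countP_roots_re_pos_eq {T : Type*} [TopologicalSpace T] [CompactSpace T] [T2Space T]
    [PreconnectedSpace T] {q : T → ℂ[X]} {n : ℕ} (hdeg : ∀ t, (q t).natDegree = n)
    (hne : ∀ t, q t ≠ 0) (hcont : ∀ k, Continuous fun t => (q t).coeff k)
    (him : ∀ t z, z.re = 0 → (q t).eval z ≠ 0) (a b : T) :
    (q a).roots.countP (fun z => 0 < z.re) = (q b).roots.countP (fun z => 0 < z.re) := by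
  have hcard : ∀ t, (q t).roots.card = n := fun t => by
    rw [← hdeg t, (IsAlgClosed.splits (q t)).natDegree_eq_card_roots]
  have hpos : ∀ t, (q t).roots.countP (fun z => 0 < z.re) =
      (q t).roots.countP (· ∈ {z : ℂ | 0 ≤ z.re}) := fun t =>
    Multiset.countP_congr rfl fun z hz => by
      have := him t z
      have hz0 : (q t).eval z = 0 := (mem_roots'.1 hz).2
      simp only [Set.mem_ofPred_eq, eq_iff_iff]
      exact ⟨le_of_lt, fun h => lt_of_le_of_ne h fun h0 => this h0.symm hz0⟩
  have hneg : ∀ t, (q t).roots.countP (fun z => ¬ 0 < z.re) =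
      (q t).roots.countP (· ∈ {z : ℂ | z.re ≤ 0}) := fun t =>
    Multiset.countP_congr rfl fun z _ => by simp
  have hsum : ∀ t, (q t).roots.countP (fun z => 0 < z.re) +
      (q t).roots.countP (fun z => ¬ 0 < z.re) = n := fun t => by
    rw [← hcard t, ← Multiset.card_eq_countP_add_countP]
  have hiff : ∀ k, ∀ a b, k ≤ (q a).roots.countP (fun z => 0 < z.re) →
      k ≤ (q b).roots.countP (fun z => 0 < z.re) := by
    intro k a b hka
    have hkn : k ≤ n := hka.trans (by have := hsum a; omega)
    rcases Nat.eq_zero_or_pos k with rfl | hk0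
    · exact Nat.zero_le _
    have hcl : IsClopen {t | k ≤ (q t).roots.countP (fun z => 0 < z.re)} := by
      constructor
      · simp only [hpos]
        exact isClosed_le_countP_roots hdeg hne hcont
          (isClosed_le continuous_const Complex.continuous_re) k hkn
      · rw [← isClosed_compl_iff]
        have : {t | k ≤ (q t).roots.countP (fun z => 0 < z.re)}ᶜ =
            {t | n - k + 1 ≤ (q t).roots.countP (· ∈ {z : ℂ | z.re ≤ 0})} := by
          ext t
          have := hsum t
          rw [Set.mem_compl_iff, Set.mem_ofPred_eq, Set.mem_ofPred_eq, ← hneg]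
          omega
        rw [this]
        exact isClosed_le_countP_roots hdeg hne hcont
          (isClosed_le Complex.continuous_re continuous_const) _ (by omega)
    rcases isClopen_iff.1 hcl with h | h
    · exact absurd (h ▸ hka : a ∈ (∅ : Set T)) (Set.notMem_empty a)
    · exact (h.symm ▸ Set.mem_univ b : b ∈ {t | k ≤ (q t).roots.countP (fun z => 0 < z.re)})
  exact le_antisymm (hiff _ a b le_rfl) (hiff _ b a le_rfl)

end RootHomotopy

section Homotopy

open Polynomial WithZero

/-! ### Separation of scaled graphs -/

/-- If `τ • S` is separated from the inverse scaled graph of `A`, and `S` contains the scaled graph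
of `B`, then `1 - τ A B` is nonsingular: a null vector `x = τ A (B x)` would give the common point
`τ γ(x, Bx) exp(j θ(x, Bx))`. -/
theorem det_one_sub_smul_mul_ne_zero {m : ℕ} {A B : Matrix (Fin m) (Fin m) ℂ} {S : Set ℂ} {τ : ℝ}
    (hτ : 0 ≤ τ) (hsep : 0 < ⨅ z ∈ invSG A, Metric.infEDist z (τ • S)) (hB : SG B ⊆ S) :
    (1 - (τ : ℂ) • (A * B)).det ≠ 0 := by
  intro hdet
  obtain ⟨x, hx0, hx⟩ := Matrix.exists_mulVec_eq_zero_iff.2 hdet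
  rw [Matrix.sub_mulVec, Matrix.one_mulVec, Matrix.smul_mulVec, sub_eq_zero,
    ← Matrix.mulVec_mulVec] at hx
  set X : EuclideanSpace ℂ (Fin m) := WithLp.toLp 2 x with hX
  have hX0 : X ≠ 0 := fun h => hx0 (by
    have := congrArg WithLp.ofLp h
    simpa [hX] using this)
  set Y := B.toEuclideanLin X with hY
  have hXY : X = (τ : ℂ) • A.toEuclideanLin Y := by
    ext i
    have := congrFun hx i
    simpa [hX, hY, Matrix.toLpLin_apply] using this
  have hτ0 : τ ≠ 0 := by
    rintro rfl
    exact hX0 (by rw [hXY]; simp)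
  have hτpos : 0 < τ := lt_of_le_of_ne hτ hτ0.symm
  set W := A.toEuclideanLin Y with hW
  have hW0 : W ≠ 0 := by
    intro h; exact hX0 (by rw [hXY, h, smul_zero])
  have hY0 : Y ≠ 0 := by
    intro h; exact hW0 (by rw [hW, h, map_zero])
  have hnorm : ‖X‖ = τ * ‖W‖ := by
    rw [hXY, norm_smul, Complex.norm_real, Real.norm_of_nonneg hτ]
  have hWn : ‖W‖ ≠ 0 := norm_ne_zero_iff.2 hW0
  have hgain : gain W Y = τ * gain X Y := by
    rw [gain, gain, hnorm]; field_simp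
  have hphase : phase W Y = phase X Y := by
    rw [phase, phase, hnorm]
    congr 1
    have : (inner ℂ X Y).re = τ * (inner ℂ W Y).re := by
      rw [hXY, inner_smul_left, Complex.conj_ofReal, Complex.re_ofReal_mul]
    rw [this]
    have hYn : ‖Y‖ ≠ 0 := norm_ne_zero_iff.2 hY0
    field_simp
  have hmem : (gain X Y : ℂ) * Complex.exp (Complex.I * (phase X Y : ℂ)) ∈ S :=
    hB ⟨X, hX0, hY0, .inl rfl⟩
  have hz : (gain W Y : ℂ) * Complex.exp (Complex.I * (phase W Y : ℂ)) ∈ invSG A :=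
    ⟨Y, hY0, hW0, .inl rfl⟩
  have hzmem : (gain W Y : ℂ) * Complex.exp (Complex.I * (phase W Y : ℂ)) ∈ τ • S := by
    refine ⟨_, hmem, ?_⟩
    simp only [hgain, hphase, Complex.real_smul]
    push_cast; ring
  refine hsep.not_ge ((iInf₂_le _ hz).trans ?_)
  rw [Metric.infEDist_zero_of_mem hzmem]

/-! ### Residue maps on the extended imaginary axis -/

theorem IsResidueMap.ne_zero {K Γ₀ F : Type*} [Field K] [LinearOrderedCommGroupWithZero Γ₀]
    [Field F] {v : Valuation K Γ₀} {ev : K → F} (h : IsResidueMap v ev) {x : K} (hx : v x = 1) :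
    ev x ≠ 0 := by
  intro h0
  have hx0 : x ≠ 0 := by rintro rfl; simp at hx
  have h1 := h.map_mul hx.le (y := x⁻¹) (by rw [map_inv₀, hx, inv_one])
  rw [mul_inv_cancel₀ hx0, h.map_one, h0, zero_mul] at h1
  exact one_ne_zero h1

theorem IsResidueMap.val_det_one_sub_smul_mul {K Γ₀ F n : Type*} [Field K]
    [LinearOrderedCommGroupWithZero Γ₀] [Field F] [Fintype n] [DecidableEq n] {v : Valuation K Γ₀}
    {ev : K → F} (h : IsResidueMap v ev) {A B : Matrix n n K} (hA : IntegralAt v A)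
    (hB : IntegralAt v B) {c : K} (hc : v c ≤ 1)
    (hdet : (1 - ev c • (A.map ev * B.map ev)).det ≠ 0) : v (1 - c • (A * B)).det = 1 := by
  have hcI : IntegralAt v (c • (A * B)) := fun i j => by
    rw [Matrix.smul_apply, smul_eq_mul, v.map_mul]
    exact mul_le_one' hc (hA.mul hB i j)
  refine h.val_det_eq_one (IntegralAt.one.sub hcI) ?_
  rw [h.map_matrix_sub .one hcI, h.map_matrix_one]
  convert hdet using 3
  ext i j
  rw [← h.map_matrix_mul hA hB]
  exact h.map_mul hc (hA.mul hB i j)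

theorem IsResidueMap.comp {K Γ₀ F E : Type*} [Field K] [LinearOrderedCommGroupWithZero Γ₀]
    [Field F] [Field E] {v : Valuation K Γ₀} {ev : K → F} (h : IsResidueMap v ev) (φ : F →+* E) :
    IsResidueMap v (fun x => φ (ev x)) where
  map_zero := by rw [h.map_zero, _root_.map_zero]
  map_one := by rw [h.map_one, _root_.map_one]
  map_add hx hy := by rw [h.map_add hx hy, _root_.map_add]
  map_mul hx hy := by rw [h.map_mul hx hy, _root_.map_mul]
  val_eq_one hx h0 := h.val_eq_one hx ((map_ne_zero φ).1 h0)

open Classical in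
theorem isProper_iff_integralAt {ι : Type*} (G : Matrix ι ι (RatFunc ℝ)) :
    IsProper G ↔ IntegralAt (RatFunc.inftyValuation ℝ) G :=
  forall₂_congr fun i j => (inftyValuation_le_one_iff (G i j)).symm

theorem valAt_C_le_one (s : ℂ) (c : ℝ) : valAt s (RatFunc.C c) ≤ 1 := by
  rw [valAt_le_one_iff]; simp

open Classical in
theorem inftyValuation_C_le_one (c : ℝ) : RatFunc.inftyValuation ℝ (RatFunc.C c) ≤ 1 := by
  rw [inftyValuation_le_one_iff]; simp

theorem valueAtInfty_C (c : ℝ) : valueAtInfty (RatFunc.C c) = c := by simp [valueAtInfty]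

/-! ### The zeros of the return difference along the homotopy -/

/-- A family of polynomials with continuous coefficients. -/
def ContinuousCoeff {T : Type*} [TopologicalSpace T] (f : T → ℝ[X]) : Prop :=
  ∀ k, Continuous fun t => (f t).coeff k

namespace ContinuousCoeff

variable {T ι : Type*} [TopologicalSpace T]

theorem const (p : ℝ[X]) : ContinuousCoeff fun _ : T => p := fun _ => continuous_const

theorem mul {f g : T → ℝ[X]} (hf : ContinuousCoeff f) (hg : ContinuousCoeff g) :
    ContinuousCoeff fun t => f t * g t := fun k => by
  simp only [coeff_mul]
  exact continuous_finsetSum _ fun x _ => (hf x.1).mul (hg x.2)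

theorem sub {f g : T → ℝ[X]} (hf : ContinuousCoeff f) (hg : ContinuousCoeff g) :
    ContinuousCoeff fun t => f t - g t := fun k => by
  simp only [coeff_sub]
  exact (hf k).sub (hg k)

theorem sum (s : Finset ι) {f : ι → T → ℝ[X]} (hf : ∀ i ∈ s, ContinuousCoeff (f i)) :
    ContinuousCoeff fun t => ∑ i ∈ s, f i t := fun k => by
  simp only [finsetSum_coeff]
  exact continuous_finsetSum _ fun i hi => hf i hi k

theorem prod (s : Finset ι) {f : ι → T → ℝ[X]} (hf : ∀ i ∈ s, ContinuousCoeff (f i)) :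
    ContinuousCoeff fun t => ∏ i ∈ s, f i t := by
  classical
  induction s using Finset.induction_on with
  | empty => simpa using const 1
  | insert a s ha ih =>
    simp only [Finset.prod_insert ha]
    exact (hf a (Finset.mem_insert_self a s)).mul
      (ih fun i hi => hf i (Finset.mem_insert_of_mem hi))

theorem C {c : T → ℝ} (hc : Continuous c) : ContinuousCoeff fun t => Polynomial.C (c t) :=
  fun k => by
    simp only [coeff_C]
    split_ifs
    exacts [hc, continuous_const]

theorem det {n : Type*} [Fintype n] [DecidableEq n] {A : T → Matrix n n ℝ[X]}
    (hA : ∀ i j, ContinuousCoeff fun t => A t i j) : ContinuousCoeff fun t => (A t).det := by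
  simp only [Matrix.det_apply']
  exact sum _ fun σ _ => (const _).mul (prod _ fun i _ => hA _ _)

end ContinuousCoeff

/-- A matrix of rational functions without imaginary poles has a common denominator without
imaginary zeros. -/
theorem exists_common_denom {n : Type*} [Fintype n] {L : Matrix n n (RatFunc ℝ)}
    (hL : ∀ s : ℂ, s.re = 0 → IntegralAt (valAt s) L) :
    ∃ (E : ℝ[X]) (B : Matrix n n ℝ[X]), E ≠ 0 ∧ (∀ s : ℂ, s.re = 0 → zeroMult s E = 0) ∧
      ∀ i j, algebraMap ℝ[X] (RatFunc ℝ) (B i j) = algebraMap _ _ E * L i j := by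
  obtain ⟨E, hE0, hEim, hdvd⟩ : ∃ E : ℝ[X], E ≠ 0 ∧ (∀ s : ℂ, s.re = 0 → zeroMult s E = 0) ∧
      ∀ i j, (L i j).denom ∣ E := by
    have hE : ∏ i, ∏ j, (L i j).denom ≠ 0 := Finset.prod_ne_zero_iff.2 fun i _ =>
      Finset.prod_ne_zero_iff.2 fun j _ => (L i j).denom_ne_zero
    refine ⟨∏ i, ∏ j, (L i j).denom, hE, fun s hs => ?_, fun i j => ?_⟩
    · rw [zeroMult_eq_zero_iff s hE, eval₂_finsetProd]
      refine Finset.prod_ne_zero_iff.2 fun i _ => ?_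
      rw [eval₂_finsetProd]
      exact Finset.prod_ne_zero_iff.2 fun j _ => (valAt_le_one_iff s _).1 (hL s hs i j)
    · exact (Finset.dvd_prod_of_mem (fun j => (L i j).denom) (Finset.mem_univ j)).trans
        (Finset.dvd_prod_of_mem (fun i => ∏ j, (L i j).denom) (Finset.mem_univ i))
  choose k hk using hdvd
  refine ⟨E, Matrix.of fun i j => (L i j).num * k i j, hE0, hEim, fun i j => ?_⟩
  rw [Matrix.of_apply, hk i j, map_mul, map_mul, mul_right_comm]
  congr 1
  nth_rw 3 [← RatFunc.num_div_denom (L i j)]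
  rw [mul_div_cancel₀ _ (RatFunc.algebraMap_ne_zero (L i j).denom_ne_zero)]

open Classical in
/-- If `det (1 - t L)` has no zero on the extended imaginary axis for `0 ≤ t ≤ 1`, then
`det (1 - L)` has as many zeros as poles in the open right half-plane. -/
theorem exists_fraction_det_one_sub {n : Type*} [Fintype n] [DecidableEq n]
    {L : Matrix n n (RatFunc ℝ)} (hL : ∀ s : ℂ, s.re = 0 → IntegralAt (valAt s) L)
    (him : ∀ t ∈ Set.Icc (0 : ℝ) 1, ∀ s : ℂ, s.re = 0 →
      valAt s (1 - RatFunc.C t • L).det = 1)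
    (hinf : ∀ t ∈ Set.Icc (0 : ℝ) 1,
      RatFunc.inftyValuation ℝ (1 - RatFunc.C t • L).det = 1) :
    ∃ a b : ℝ[X], a ≠ 0 ∧ b ≠ 0 ∧
      algebraMap _ _ b * (1 - L).det = algebraMap ℝ[X] (RatFunc ℝ) a ∧
      (a.aroots ℂ).countP (fun z => 0 < z.re) = (b.aroots ℂ).countP (fun z => 0 < z.re) := by
  obtain ⟨E, B, hE, hEim, hB⟩ := exists_common_denom hL
  let q : ℝ → ℝ[X] := fun t => (E • (1 : Matrix n n ℝ[X]) - Polynomial.C t • B).det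
  have hq : ∀ t, algebraMap ℝ[X] (RatFunc ℝ) (q t)
      = algebraMap _ _ (E ^ Fintype.card n) * (1 - RatFunc.C t • L).det := fun t => by
    rw [map_pow, ← Matrix.det_smul, RingHom.map_det]
    congr 1
    ext i j
    simp only [RingHom.mapMatrix_apply, Matrix.map_apply, Matrix.sub_apply, Matrix.smul_apply,
      smul_eq_mul, map_sub, map_mul, hB, Matrix.one_apply, RatFunc.algebraMap_C]
    split_ifs
    · rw [map_one]; ring
    · rw [map_zero]; ring
  have hEpow : E ^ Fintype.card n ≠ 0 := pow_ne_zero _ hE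
  have hq0 : q 0 = E ^ Fintype.card n := by
    simp only [q, map_zero, zero_smul, sub_zero, Matrix.det_smul, Matrix.det_one, mul_one]
  have hdet0 : ∀ t ∈ Set.Icc (0 : ℝ) 1, (1 - RatFunc.C t • L).det ≠ 0 := fun t ht h0 => by
    have := hinf t ht
    rw [h0, map_zero] at this
    exact zero_ne_one this
  have hqne : ∀ t ∈ Set.Icc (0 : ℝ) 1, q t ≠ 0 := fun t ht h0 => by
    have := hq t
    rw [h0, map_zero] at this
    exact mul_ne_zero (RatFunc.algebraMap_ne_zero hEpow) (hdet0 t ht) this.symm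
  have hdeg : ∀ t ∈ Set.Icc (0 : ℝ) 1, (q t).natDegree = (E ^ Fintype.card n).natDegree :=
    fun t ht => by
      have := congrArg (RatFunc.inftyValuation ℝ) (hq t)
      rw [map_mul, hinf t ht, mul_one, RatFunc.inftyValuation_apply,
        RatFunc.inftyValuation_apply, RatFunc.inftyValuation.polynomial ℝ (hqne t ht),
        RatFunc.inftyValuation.polynomial ℝ hEpow, exp_inj] at this
      exact_mod_cast this
  have hqim : ∀ t ∈ Set.Icc (0 : ℝ) 1, ∀ s : ℂ, s.re = 0 → zeroMult s (q t) = 0 :=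
    fun t ht s hs => by
      have := congrArg (valAt s) (hq t)
      rw [map_mul, him t ht s hs, mul_one, map_pow, map_pow, valAt_algebraMap s hE, hEim s hs,
        valAt_algebraMap s (hqne t ht)] at this
      simpa using this
  have hcoeff : ContinuousCoeff fun t : unitInterval => q t := by
    refine ContinuousCoeff.det fun i j => ?_
    simp only [Matrix.sub_apply, Matrix.smul_apply, smul_eq_mul]
    exact (ContinuousCoeff.const _).sub
      ((ContinuousCoeff.C continuous_subtype_val).mul (ContinuousCoeff.const _))
  have hcount := countP_roots_re_pos_eq (T := unitInterval)
    (q := fun t => (q t).map (algebraMap ℝ ℂ)) (n := (E ^ Fintype.card n).natDegree)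
    (fun t => by rw [natDegree_map, hdeg t t.2]) (fun t => map_complex_ne_zero (hqne t t.2))
    (fun k => by
      simp only [coeff_map]
      exact Complex.continuous_ofReal.comp (hcoeff k))
    (fun t z hz => by
      rw [eval_map]
      exact (zeroMult_eq_zero_iff z (hqne t t.2)).1 (hqim t t.2 z hz)) 1 0
  have h1 : (1 : ℝ) ∈ Set.Icc (0 : ℝ) 1 := ⟨zero_le_one, le_rfl⟩
  refine ⟨q 1, E ^ Fintype.card n, hqne 1 h1, hEpow, ?_, ?_⟩
  · rw [hq 1, map_one, one_smul]
  · rw [← hq0]; exact hcount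

end Homotopy

section Dominance

open Polynomial WithZero

/-! ### Dominance of the uncertain loop -/

open Classical in
/-- Without unstable cancellation, no point of the closed right half-plane loses multiplicity as a
pole of the product: pointwise the count is subadditive, and the totals agree. -/
theorem NoUnstableCancellation.polarSize_mul {m : ℕ} {P C : Matrix (Fin m) (Fin m) (RatFunc ℝ)}
    (h : NoUnstableCancellation P C) {s : ℂ} (hs : 0 ≤ s.re) :
    polarSize (valAt s) (P * C) = polarSize (valAt s) P * polarSize (valAt s) C := by
  have hle : ∀ z, (poles (P * C)).count z ≤ (poles P).count z + (poles C).count z := fun z => by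
    have := polarSize_mul_le (v := valAt z) P C
    rw [polarSize_valAt, polarSize_valAt, polarSize_valAt, ← exp_add, exp_le_exp] at this
    exact_mod_cast this
  have hfil : (poles (P * C)).filter (fun s => 0 ≤ s.re) =
      (poles P + poles C).filter fun s => 0 ≤ s.re := by
    refine Multiset.eq_of_le_of_card_le (Multiset.filter_le_filter _ (Multiset.le_iff_count.2
      fun z => by rw [Multiset.count_add]; exact hle z)) ?_
    rw [← Multiset.countP_eq_card_filter, ← Multiset.countP_eq_card_filter, Multiset.countP_add]
    exact h.ge
  have hcount := congrArg (Multiset.count s) hfil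
  rw [Multiset.count_filter, Multiset.count_filter, if_pos hs, if_pos hs, Multiset.count_add]
    at hcount
  rw [polarSize_valAt, polarSize_valAt, polarSize_valAt, ← exp_add, hcount]
  push_cast; rfl

/-- Separation gives a nonsingular return difference along the homotopy at every finite
frequency. -/
theorem valAt_det_one_sub_smul_mul {m : ℕ} {G Δ : Matrix (Fin m) (Fin m) (RatFunc ℝ)}
    {ρ : EReal → Set ℂ} {τ : ℝ} (hτ : 0 ≤ τ)
    (hsep : ∀ ω, 0 < ⨅ z ∈ invSG (freqResp G ω), Metric.infEDist z (τ • ρ ω))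
    (hΔ : ∀ ω, SG (freqResp Δ ω) ⊆ ρ ω) {s : ℂ} (hs : s.re = 0)
    (hGs : IntegralAt (valAt s) G) (hΔs : IntegralAt (valAt s) Δ) :
    valAt s (1 - RatFunc.C τ • (G * Δ)).det = 1 := by
  have hω : ∀ A : Matrix (Fin m) (Fin m) (RatFunc ℝ), freqResp A ((s.im : ℝ) : EReal)
      = A.map (RatFunc.eval (algebraMap ℝ ℂ) s) := fun A => by
    have h : Complex.I * (s.im : ℂ) = s := by apply Complex.ext <;> simp [hs]
    rw [freqResp, if_neg (by simp), EReal.toReal_coe, h]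
  refine (isResidueMap_eval s).val_det_one_sub_smul_mul hGs hΔs (valAt_C_le_one s τ) ?_
  rw [RatFunc.eval_C, ← hω, ← hω]
  exact det_one_sub_smul_mul_ne_zero hτ (hsep _) (hΔ _)

open Classical in
/-- Separation gives a nonsingular return difference along the homotopy at infinity. -/
theorem inftyValuation_det_one_sub_smul_mul {m : ℕ} {G Δ : Matrix (Fin m) (Fin m) (RatFunc ℝ)}
    {ρ : EReal → Set ℂ} {τ : ℝ} (hτ : 0 ≤ τ)
    (hsep : ∀ ω, 0 < ⨅ z ∈ invSG (freqResp G ω), Metric.infEDist z (τ • ρ ω))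
    (hΔ : ∀ ω, SG (freqResp Δ ω) ⊆ ρ ω) (hGp : IsProper G) (hΔp : IsProper Δ) :
    RatFunc.inftyValuation ℝ (1 - RatFunc.C τ • (G * Δ)).det = 1 := by
  have hω : ∀ A : Matrix (Fin m) (Fin m) (RatFunc ℝ), freqResp A ⊤
      = A.map fun f => Complex.ofRealHom (valueAtInfty f) := fun A => by
    rw [freqResp, if_pos (.inl rfl)]; rfl
  refine (isResidueMap_valueAtInfty.comp Complex.ofRealHom).val_det_one_sub_smul_mul
    ((isProper_iff_integralAt G).1 hGp) ((isProper_iff_integralAt Δ).1 hΔp)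
    (inftyValuation_C_le_one τ) ?_
  rw [valueAtInfty_C, ← hω, ← hω]
  exact det_one_sub_smul_mul_ne_zero hτ (hsep _) (hΔ _)

end Dominance

end SGDominance

open SGDominance in
theorem mainTheorem5 (m p : ℕ)
    (P C : Matrix (Fin m) (Fin m) (RatFunc ℝ))
    (hP : IsProper P) (hC : IsProper C)
    (hPC : NoUnstableCancellation P C) (hCP : NoUnstableCancellation C P)
    (hinv : IsUnit (1 - C * P))
    (hG : IsDominant ((1 - C * P)⁻¹ * C) p)
    (ρ : EReal → Set ℂ) (hρ : ∀ ω : EReal, IsUncertaintyRegion (ρ ω))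
    (hsep : ∀ ω : EReal, ∀ τ ∈ Set.Icc (0 : ℝ) 1,
      0 < ⨅ z ∈ invSG (freqResp ((1 - C * P)⁻¹ * C) ω), Metric.infEDist z (τ • ρ ω))
    (Δ : Matrix (Fin m) (Fin m) (RatFunc ℝ)) (hΔ : Δ ∈ uncertaintySet m ρ) :
    IsFeedbackDominant (P + Δ) C p := by
  classical
  obtain ⟨⟨hΔp, hΔstab⟩, hΔρ⟩ := hΔ
  have huCP : IsUnit (1 - C * P).det := (Matrix.isUnit_iff_isUnit_det _).1 hinv
  have hdetPC : (1 - P * C).det ≠ 0 := by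
    rw [← Matrix.det_one_sub_mul_comm]; exact huCP.ne_zero
  have huPC : IsUnit (1 - P * C).det := isUnit_iff_ne_zero.2 hdetPC
  have hGeq : (1 - C * P)⁻¹ * C = C * (1 - P * C)⁻¹ := by
    have h : C * (1 - P * C) = (1 - C * P) * C := by noncomm_ring
    calc (1 - C * P)⁻¹ * C = (1 - C * P)⁻¹ * (C * (1 - P * C)) * (1 - P * C)⁻¹ := by
          rw [Matrix.mul_assoc, Matrix.mul_assoc C, Matrix.mul_nonsing_inv _ huPC, Matrix.mul_one]
      _ = C * (1 - P * C)⁻¹ := by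
          rw [h, ← Matrix.mul_assoc, Matrix.nonsing_inv_mul _ huCP, Matrix.one_mul]
  set G := (1 - C * P)⁻¹ * C with hGdef
  obtain ⟨⟨hGp, hGim⟩, hGcount⟩ := hG
  -- factorization of the return difference of the uncertain loop
  have hfac : (1 - (P + Δ) * C).det = (1 - P * C).det * (1 - G * Δ).det := by
    rw [← Matrix.det_one_sub_mul_comm C, ← Matrix.det_one_sub_mul_comm C P, ← Matrix.det_mul]
    congr 1
    have h : C = (1 - C * P) * G := by
      rw [hGdef, ← Matrix.mul_assoc, Matrix.mul_nonsing_inv _ huCP, Matrix.one_mul]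
    calc 1 - C * (P + Δ) = (1 - C * P) - C * Δ := by noncomm_ring
      _ = (1 - C * P) - ((1 - C * P) * G) * Δ := by rw [← h]
      _ = (1 - C * P) * (1 - G * Δ) := by noncomm_ring
  -- the return difference at infinity
  have hGI := (isProper_iff_integralAt G).1 hGp
  have hΔI := (isProper_iff_integralAt Δ).1 hΔp
  have hPI := (isProper_iff_integralAt P).1 hP
  have hCI := (isProper_iff_integralAt C).1 hC
  have hinf : ∀ t ∈ Set.Icc (0 : ℝ) 1,
      RatFunc.inftyValuation ℝ (1 - RatFunc.C t • (G * Δ)).det = 1 := fun t ht =>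
    inftyValuation_det_one_sub_smul_mul ht.1 (fun ω => hsep ω t ht) hΔρ hGp hΔp
  have h1mem : (1 : ℝ) ∈ Set.Icc (0 : ℝ) 1 := ⟨zero_le_one, le_rfl⟩
  have hinf1 : RatFunc.inftyValuation ℝ (1 - G * Δ).det = 1 := by
    simpa using hinf 1 h1mem
  -- `1 + G * P` is a proper inverse of `1 - C * P`
  have hinfPC : RatFunc.inftyValuation ℝ (1 - P * C).det = 1 := by
    rw [← Matrix.det_one_sub_mul_comm]
    have h1 : (1 - C * P) * (1 + G * P) = 1 := by
      have h : (1 - C * P) * G = C := by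
        rw [hGdef, ← Matrix.mul_assoc, Matrix.mul_nonsing_inv _ huCP, Matrix.one_mul]
      rw [Matrix.mul_add, ← Matrix.mul_assoc, h, Matrix.mul_one, sub_add_cancel]
    have h2 := congrArg (fun A => RatFunc.inftyValuation ℝ A.det) h1
    simp only [Matrix.det_mul, map_mul, Matrix.det_one, map_one] at h2
    refine le_antisymm (IntegralAt.one.sub (hCI.mul hPI)).det ?_
    rw [← h2]
    exact mul_le_of_le_one_right' (IntegralAt.one.add (hGI.mul hPI)).det
  have hinfR : RatFunc.inftyValuation ℝ (1 - (P + Δ) * C).det = 1 := by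
    rw [hfac, map_mul, hinfPC, hinf1, one_mul]
  have hPΔI := hPI.add hΔI
  have hRI := IntegralAt.one.sub (hPΔI.mul hCI)
  -- the return difference on the imaginary axis
  have hGs : ∀ s : ℂ, s.re = 0 → s ∉ poles G := fun s hs h => hGim s h hs
  have hΔs : ∀ s : ℂ, 0 ≤ s.re → s ∉ poles Δ := fun s hs h => (hΔstab s h).not_ge hs
  have him : ∀ t ∈ Set.Icc (0 : ℝ) 1, ∀ s : ℂ, s.re = 0 →
      valAt s (1 - RatFunc.C t • (G * Δ)).det = 1 := fun t ht s hs =>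
    valAt_det_one_sub_smul_mul ht.1 (fun ω => hsep ω t ht) hΔρ hs (integralAt_valAt (hGs s hs))
      (integralAt_valAt (hΔs s hs.ge))
  obtain ⟨a, b, ha, hb, hab, hcount⟩ := exists_fraction_det_one_sub (L := G * Δ)
    (fun s hs => (integralAt_valAt (hGs s hs)).mul (integralAt_valAt (hΔs s hs.ge))) him hinf
  have hdetR : (1 - (P + Δ) * C).det ≠ 0 := fun h0 => by
    rw [h0, map_zero] at hinfR
    exact zero_ne_one hinfR
  -- the poles of the uncertain loop in the closed right half-plane
  have hpoles : ∀ s : ℂ, 0 ≤ s.re → valAt s (1 - G * Δ).det *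
      polarSize (valAt s) (closedLoop (P + Δ) C) = polarSize (valAt s) G := fun s hs => by
    have h1 := det_mul_polarSize_closedLoop (v := valAt s) hdetR
    have h2 := det_mul_polarSize_of_no_cancellation (v := valAt s) hdetPC
      (hPC.polarSize_mul hs) (hCP.polarSize_mul hs)
    rw [← hGeq] at h2
    rw [polarSize_add_integral (integralAt_valAt (hΔs s hs)), ← h2, hfac, map_mul, mul_assoc] at h1
    exact mul_left_cancel₀ ((map_ne_zero _).2 hdetPC) h1
  refine ⟨?_, ⟨?_, fun s hs hre => ?_⟩, ?_⟩
  · have h := isResidueMap_valueAtInfty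
    rw [WellPosed, ← h.map_matrix_mul hPΔI hCI, ← h.map_matrix_one,
      ← h.map_matrix_sub .one (hPΔI.mul hCI), Matrix.isUnit_iff_isUnit_det, ← h.map_det hRI]
    exact isUnit_iff_ne_zero.2 (h.ne_zero hinfR)
  · rw [isProper_iff_integralAt]
    refine (IntegralAt.fromBlocks .one hCI.neg hPΔI.neg .one).inv ?_
    rw [Matrix.det_fromBlocks_one₁₁, Matrix.neg_mul, Matrix.mul_neg, neg_neg]
    exact hinfR
  · have h := hpoles s hre.ge
    have h1 : valAt s (1 - G * Δ).det = 1 := by simpa using him 1 h1mem s hre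
    rw [h1, one_mul, (polarSize_valAt_eq_one_iff s G).2 (hGs s hre)] at h
    exact (polarSize_valAt_eq_one_iff s _).1 h hs
  · have hmult : ∀ s : ℂ, 0 ≤ s.re → (poles (closedLoop (P + Δ) C)).count s + zeroMult s b
        = (poles G).count s + zeroMult s a := fun s hs => by
      have h := hpoles s hs
      have h1 := congrArg (valAt s) hab
      rw [map_mul, valAt_algebraMap s hb, valAt_algebraMap s ha] at h1
      have h2 := congrArg (fun x => WithZero.exp (-(zeroMult s b : ℤ)) * x) h
      rw [← mul_assoc, h1, polarSize_valAt, polarSize_valAt, ← WithZero.exp_add,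
        ← WithZero.exp_add, WithZero.exp_inj] at h2
      omega
    have hfil : (poles (closedLoop (P + Δ) C) + b.aroots ℂ).filter (fun s => 0 < s.re) =
        (poles G + a.aroots ℂ).filter fun s => 0 < s.re := by
      ext s
      rw [Multiset.count_filter, Multiset.count_filter]
      split_ifs with hs
      · rw [Multiset.count_add, Multiset.count_add, Polynomial.aroots, Polynomial.aroots,
          Polynomial.count_roots, Polynomial.count_roots]
        exact hmult s hs.le
      · rfl
    have hcard := congrArg Multiset.card hfil
    rw [← Multiset.countP_eq_card_filter, ← Multiset.countP_eq_card_filter, Multiset.countP_add,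
      Multiset.countP_add, hcount] at hcard
    rw [← hGcount]
    exact Nat.add_right_cancel hcard
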